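/- Let $R$ be a local domain that is Noetherian and normal (integrally closed in its fraction field), with fraction field $K$, and assume $R \neq K$. If $R$ admits an altered local uniformization, then the étale open topology over $K$ refines the $R$-adic topology; that is, for every $K$-variety $V$ every subset of $V(K)$ that is open in the $R$-adic topology is open in the étale open topology. Here: - A $K$-variety is a separated $K$-scheme of finite type (not necessarily irreducible or reduced), and $V(K)$ is its set of $K$-points. The étale open topology on $V(K)$ is the topology with basis the sets $f(W(K))$, where $f\colon W \to V$ is an étale morphism of $K$-varieties. - The $R$-adic topology on $K$ is the topology with basis $\{aR+b : a\in K^\times,\ b\in K\}$. It is a field topology, and it induces the $R$-adic topology on $V(K)$ for every $K$-variety $V$: for $V$ affine this is the coarsest topology making all regular functions $V(K)\to K$ continuous, and in general a subset of $V(K)$ is open if and only if its intersection with $U(K)$ is open in $U(K)$ for every affine open $U\subseteq V$. - An altered local uniformization of $R$ consists of finitely many regular integral schemes $X_1,\dots,X_n$ with generically finite dominant morphisms $X_i\to\operatorname{Spec}R$ of finite type such that every valuation ring $\mathcal O$ of $K$ containing $R$ can be prolonged to a valuation ring $\mathcal O^*$ centered on some $X_i$: there are an index $i$, a valuation ring $\mathcal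 O^*$ with an injective local homomorphism $\mathcal O\to\mathcal O^*$, and a morphism $\operatorname{Spec}\mathcal O^*\to X_i$ such that the compositions $\operatorname{Spec}\mathcal O^*\to X_i\to\operatorname{Spec}R$ and $\operatorname{Spec}\mathcal O^*\to\operatorname{Spec}\mathcal O\to\operatorname{Spec}R$ agree. A scheme is regular if it is locally Noetherian and all its stalks are regular local rings; a morphism to an irreducible scheme is generically finite if it is finite over some nonempty open subset of the target. -/

import Mathlib

open AlgebraicGeometry CategoryTheory

universe u

noncomputable section

namespace EtaleOpen

/-! ### Varieties over a field and their rational points -/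

/-- A `K`-variety is a separated `K`-scheme of finite type (not necessarily irreducible or
reduced). -/
structure IsVariety {K : Type u} [Field K] (V : Over (Spec (CommRingCat.of K))) : Prop where
  isSeparated : IsSeparated V.hom
  locallyOfFiniteType : LocallyOfFiniteType V.hom
  quasiCompact : QuasiCompact V.hom

/-- The set `V(K)` of `K`-points of a `K`-scheme `V`: the `K`-morphisms `Spec K ⟶ V`. -/
abbrev Points {K : Type u} [Field K] (V : Over (Spec (CommRingCat.of K))) : Type u :=
  Over.mk (𝟙 (Spec (CommRingCat.of K))) ⟶ V

/-- The map `W(K) → V(K)` induced by a morphism of `K`-schemes `W ⟶ V`. -/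
def Points.map {K : Type u} [Field K] {W V : Over (Spec (CommRingCat.of K))} (f : W ⟶ V)
    (p : Points W) : Points V :=
  p ≫ f

/-- The value in `K` of a global function on `V` at a `K`-point of `V`. -/
def Points.eval {K : Type u} [Field K] {V : Over (Spec (CommRingCat.of K))}
    (s : Γ(V.left, ⊤)) (p : Points V) : K :=
  (Scheme.ΓSpecIso (CommRingCat.of K)).hom (p.left.appTop s)

/-! ### The étale open topology -/

/-- The subsets of `V(K)` of the form `f(W(K))`, for `f : W ⟶ V` an étale morphism of
`K`-varieties. -/
def IsEtaleImage {K : Type u} [Field K] (V : Over (Spec (CommRingCat.of K)))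
    (S : Set (Points V)) : Prop :=
  ∃ (W : Over (Spec (CommRingCat.of K))) (f : W ⟶ V),
    IsVariety W ∧ Etale f.left ∧ S = Set.range (Points.map f)

/-- The étale open topology on `V(K)`: the étale images form a basis. -/
@[reducible]
def etaleOpenTopology {K : Type u} [Field K] (V : Over (Spec (CommRingCat.of K))) :
    TopologicalSpace (Points V) :=
  TopologicalSpace.generateFrom {S | IsEtaleImage V S}

/-! ### The `R`-adic topology -/

/-- The `R`-adic topology on the fraction field `K` of a domain `R`: the sets `a R + b` with
`a ∈ Kˣ` and `b ∈ K` form a basis. (This is not the topology given by the powers of an ideal.) -/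
@[reducible]
def adicTopology (R K : Type u) [CommRing R] [Field K] [Algebra R K] : TopologicalSpace K :=
  TopologicalSpace.generateFrom
    {S | ∃ a b : K, a ≠ 0 ∧ S = Set.range fun r : R => a * algebraMap R K r + b}

/-- An open subscheme of a `K`-scheme, as a `K`-scheme. -/
def openSubscheme {K : Type u} [Field K] (V : Over (Spec (CommRingCat.of K)))
    (U : V.left.Opens) : Over (Spec (CommRingCat.of K)) :=
  Over.mk (U.ι ≫ V.hom)

/-- The inclusion of an open subscheme, as a morphism of `K`-schemes. -/
def openSubschemeι {K : Type u} [Field K] (V : Over (Spec (CommRingCat.of K)))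
    (U : V.left.Opens) : openSubscheme V U ⟶ V :=
  Over.homMk U.ι

/-- For a field topology `τ` on `K` and an affine `K`-variety `V`, the `τ`-topology on `V(K)`: the
coarsest topology for which all regular functions `V(K) → K` are continuous. For a closed subvariety
of affine space this is the subspace topology of the product topology on `Kⁿ`. -/
@[reducible]
def affinePointsTopology {K : Type u} [Field K] (τ : TopologicalSpace K)
    (V : Over (Spec (CommRingCat.of K))) : TopologicalSpace (Points V) :=
  ⨅ s : Γ(V.left, ⊤), TopologicalSpace.induced (Points.eval s) τ

/-- The topology on `V(K)` induced by a field topology `τ` on `K`, for an arbitrary `K`-variety `V`: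
it is glued from the `τ`-topologies on `U(K)` for the affine open subschemes `U` of `V`, i.e. a
subset of `V(K)` is open if and only if its intersection with each `U(K)` is open in `U(K)`. -/
@[reducible]
def pointsTopology {K : Type u} [Field K] (τ : TopologicalSpace K)
    (V : Over (Spec (CommRingCat.of K))) : TopologicalSpace (Points V) :=
  ⨆ U : V.left.affineOpens,
    TopologicalSpace.coinduced (Points.map (openSubschemeι V U))
      (affinePointsTopology τ (openSubscheme V U))

/-! ### Altered local uniformization -/

/-- A scheme is regular if it is locally Noetherian and all its stalks are regular local rings. -/
structure IsRegularScheme (X : Scheme.{u}) : Prop where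
  isLocallyNoetherian : IsLocallyNoetherian X
  isRegularLocalRing_stalk : ∀ x : X, IsRegularLocalRing (X.presheaf.stalk x)

/-- A morphism to an irreducible scheme is generically finite if it is finite over some non-empty
open subset of the target. -/
def IsGenericallyFinite {X Y : Scheme.{u}} (f : X ⟶ Y) : Prop :=
  ∃ U : Y.Opens, (U : Set Y).Nonempty ∧ IsFinite (f ∣_ U)

/-- The inclusion of `R` into a valuation ring of `K` containing it. -/
def toValuationSubring (R K : Type u) [CommRing R] [Field K] [Algebra R K]
    (O : ValuationSubring K) (hO : ∀ r : R, algebraMap R K r ∈ O) : R →+* O :=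
  (algebraMap R K).codRestrict O.toSubring hO

/-- A domain `R` with fraction field `K` admits an altered local uniformization: there are finitely
many integral regular schemes `X i` with generically finite dominant morphisms `π i : X i ⟶ Spec R`
of finite type such that every valuation ring `O` of `K` containing `R` can be prolonged to a
valuation ring `O'` centered on some `X i`. Here `O'` prolongs `O` means that `O'` is a valuation
ring (of some extension field of `K`) with an injective local homomorphism `O →+* O'`,
equivalently `O' ∩ K = O`; and `O'` is centered on `X i` if there is a morphism `Spec O' ⟶ X i` for
which the square over `Spec O ⟶ Spec R` commutes. -/
def AdmitsAlteredLocalUniformization (R K : Type u) [CommRing R] [Field K] [Algebra R K] : Prop :=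
  ∃ (n : ℕ) (X : Fin n → Scheme.{u}) (π : ∀ i, X i ⟶ Spec (CommRingCat.of R)),
    (∀ i, IsIntegral (X i) ∧ IsRegularScheme (X i) ∧ IsGenericallyFinite (π i) ∧
      IsDominant (π i) ∧ LocallyOfFiniteType (π i) ∧ QuasiCompact (π i)) ∧
    ∀ (O : ValuationSubring K) (hO : ∀ r : R, algebraMap R K r ∈ O),
      ∃ (i : Fin n) (O' : Type u) (_ : CommRing O') (_ : IsDomain O') (_ : ValuationRing O')
        (φ : O →+* O') (g : Spec (CommRingCat.of O') ⟶ X i),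
        Function.Injective φ ∧ IsLocalHom φ ∧
        g ≫ π i = Spec.map (CommRingCat.ofHom φ) ≫
          Spec.map (CommRingCat.ofHom (toValuationSubring R K O hO))

end EtaleOpen

end

/-! By translation and scaling it is enough to find an étale open neighbourhood of `0` in `K` that
is contained in `R`. Choose `π ≠ 0` in the maximal ideal and a large prime `n` invertible in `R`.
The neighbourhood consists of the `x` for which `1 - x ^ n` and `π (x + 1) (x + π) ^ (n - 1)` are
both nonzero `n`-th powers. At `x = 0` the values are `1` and `π ^ n`, and being a nonzero `n`-th
power is an étale open condition. Such an `x` yields `y`, `z` with `x ^ n + y ^ n = 1` and `z ^ n (x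
+ π) = π (x + 1)`.

If `x ∉ R`, normality gives a valuation ring `O` dominating `R` with `x ∉ O`. Prolong `O` to a ring
centred on a regular affine chart `S`, at a prime `P₀` containing `π`. The contradiction comes from
showing that `x` is regular at `P₀` (`exists_mul_eq_of_curves`). Otherwise a component of the polar
locus of `x` passes through `P₀`. It is an associated prime of a principal ideal, and depth
arguments then produce a prime `P ≤ P₀` that contains the component and `π`, with `S_P` regular of
dimension at most two.

In the factorial ring `S_P` write `x = a / b` in lowest terms with `b` a non-unit. If `a` is also a
non-unit, the first curve gives `b ^ n - a ^ n = c ^ n` with coprime non-units. This cannot occur in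
dimension one, and in dimension two Fermat descent excludes it
(`HasRegularPair.pow_sub_pow_ne_pow`). So `a` is a unit, and the second curve makes `π` a unit times
the `n`-th power of a non-unit. But `n` was chosen larger than the vanishing orders of `π` on the
finitely many charts. -/

section

/-! ### Socles, depth and associated primes of principal ideals -/

section LocalSocle

open IsLocalRing

variable {B : Type*} [CommRing B]

/-- `x` is a non-zero-divisor modulo `J`. -/
def RegularMod (J : Ideal B) (x : B) : Prop := ∀ r, x * r ∈ J → r ∈ J

/-- The quotient by `I` has a nonzero element killed by the maximal ideal. -/
def HasSocle [IsLocalRing B] (I : Ideal B) : Prop :=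
  ∃ g, g ∉ I ∧ ∀ r ∈ maximalIdeal B, r * g ∈ I

/-- From `t * r = c * u`, regularity of `u` modulo `t` gives `c = d * t`; cancelling `t` leaves `r =
d * u`. -/
lemma RegularMod.swap [IsDomain B] {t u : B} (ht : t ≠ 0) (h : RegularMod (Ideal.span {t}) u) :
    RegularMod (Ideal.span {u}) t := by
  intro r hr
  obtain ⟨c, hc⟩ := Ideal.mem_span_singleton'.1 hr
  have : u * c ∈ Ideal.span {t} := by
    rw [mul_comm, hc]; exact Ideal.mul_mem_right _ _ (Ideal.mem_span_singleton_self _)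
  obtain ⟨d, rfl⟩ := Ideal.mem_span_singleton'.1 (h c this)
  have : t * (d * u) = t * r := by rw [← hc]; ring
  rw [← mul_left_cancel₀ ht this]
  exact Ideal.mul_mem_left _ _ (Ideal.mem_span_singleton_self _)

/-- This is the invariance of depth for one step of a regular sequence. If `g` represents a socle
element modulo `(J, t)`, then `u * g ≡ g' * t` modulo `J` for some `g'`, and `g'` represents a socle
element modulo `(J, u)`. -/
lemma HasSocle.exchange [IsLocalRing B] {J : Ideal B} {t u : B} (ht : RegularMod J t)
    (hu : RegularMod J u) (hum : u ∈ maximalIdeal B) (h : HasSocle (J ⊔ Ideal.span {t})) :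
    HasSocle (J ⊔ Ideal.span {u}) := by
  obtain ⟨g, hg, hm⟩ := h
  obtain ⟨j, hj, y, hy, hjy⟩ := Submodule.mem_sup.1 (hm u hum)
  obtain ⟨g', rfl⟩ := Ideal.mem_span_singleton'.1 hy
  refine ⟨g', fun hg' ↦ hg ?_, fun r hr ↦ ?_⟩
  · obtain ⟨j', hj', y', hy', hjy'⟩ := Submodule.mem_sup.1 hg'
    obtain ⟨g'', rfl⟩ := Ideal.mem_span_singleton'.1 hy'
    have : g - g'' * t ∈ J := hu _ (by
      have : u * (g - g'' * t) = j + j' * t := by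
        rw [mul_sub, ← hjy, ← hjy']; ring
      rw [this]
      exact add_mem hj (J.mul_mem_right _ hj'))
    exact Submodule.mem_sup.2 ⟨_, this, g'' * t,
      Ideal.mul_mem_left _ _ (Ideal.mem_span_singleton_self _), by ring⟩
  · obtain ⟨j', hj', y', hy', hjy'⟩ := Submodule.mem_sup.1 (hm r hr)
    obtain ⟨k, rfl⟩ := Ideal.mem_span_singleton'.1 hy'
    have : r * g' - u * k ∈ J := ht _ (by
      have : t * (r * g' - u * k) = u * j' - r * j := by
        have h1 : g' * t = u * g - j := by rw [← hjy]; ring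
        have h2 : k * t = r * g - j' := by rw [← hjy']; ring
        linear_combination r * h1 - u * h2
      rw [this]
      exact sub_mem (J.mul_mem_left _ hj') (J.mul_mem_left _ hj))
    exact Submodule.mem_sup.2 ⟨_, this, u * k,
      Ideal.mul_mem_right _ _ (Ideal.mem_span_singleton_self _), by ring⟩

lemma HasSocle.not_regularMod [IsLocalRing B] {J : Ideal B} (h : HasSocle J) {x : B}
    (hx : x ∈ maximalIdeal B) : ¬ RegularMod J x := fun hr ↦ by
  obtain ⟨g, hg, hm⟩ := h
  exact hg (hr g (hm x hx))

/-- A nonzero element of `B ⧸ J` killed by an ideal `I` is, up to a multiple, killed by a prime. -/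
lemma exists_prime_colon [IsNoetherianRing B] {J I : Ideal B} {n : B} (hn : n ∉ J)
    (hI : ∀ r ∈ I, r * n ∈ J) :
    ∃ q : Ideal B, q.IsPrime ∧ I ≤ q ∧ ∃ g, ∀ r, r ∈ q ↔ r * g ∈ J := by
  obtain ⟨P, hP, hle⟩ := exists_le_isAssociatedPrime_of_isNoetherianRing B
    (Ideal.Quotient.mk J n) (by rwa [Ne, Ideal.Quotient.eq_zero_iff_mem])
  obtain ⟨hprime, x, hx⟩ := isAssociatedPrime_iff.1 hP
  obtain ⟨g, rfl⟩ := Ideal.Quotient.mk_surjective x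
  have key : ∀ r y, r ∈ (⊥ : Submodule B (B ⧸ J)).colon {Ideal.Quotient.mk J y} ↔ r * y ∈ J := by
    intro r y
    rw [Submodule.mem_colon_singleton, Submodule.mem_bot, ← Ideal.Quotient.eq_zero_iff_mem,
      Algebra.smul_def, Ideal.Quotient.algebraMap_eq, map_mul]
  exact ⟨P, hprime, fun r hr ↦ hle ((key _ _).2 (hI r hr)), g, fun r ↦ by rw [hx, key]⟩

/-- Absence of a socle means that the maximal ideal is not an associated prime. Prime avoidance then
finds `u` outside the finitely many associated primes of both quotients. -/
lemma exists_regularMod [IsLocalRing B] [IsNoetherianRing B] {I J : Ideal B}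
    (hI : ¬ HasSocle I) (hJ : ¬ HasSocle J) :
    ∃ u ∈ maximalIdeal B, RegularMod I u ∧ RegularMod J u := by
  by_contra! hcon
  let s : Set (Ideal B) := associatedPrimes B (B ⧸ I) ∪ associatedPrimes B (B ⧸ J)
  have hs : s.Finite := (associatedPrimes.finite B _).union (associatedPrimes.finite B _)
  have hprime : ∀ q ∈ s, q.IsPrime := by rintro q (h | h) <;> exact h.1
  have hsoc : ∀ (I' : Ideal B), maximalIdeal B ∈ associatedPrimes B (B ⧸ I') → HasSocle I' := by
    intro I' h
    obtain ⟨hprime, x, hx⟩ := isAssociatedPrime_iff.1 h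
    obtain ⟨g, rfl⟩ := Ideal.Quotient.mk_surjective x
    have key : ∀ r, r ∈ maximalIdeal B ↔ r * g ∈ I' := by
      intro r
      rw [hx, Submodule.mem_colon_singleton, Submodule.mem_bot, ← Ideal.Quotient.eq_zero_iff_mem,
        Algebra.smul_def, Ideal.Quotient.algebraMap_eq, map_mul]
    refine ⟨g, fun hg ↦ hprime.ne_top ?_, fun r hr ↦ (key r).1 hr⟩
    rw [Ideal.eq_top_iff_one, key, one_mul]; exact hg
  have hnr : ∀ (I' : Ideal B) u, ¬ RegularMod I' u →
      ∃ q ∈ associatedPrimes B (B ⧸ I'), u ∈ q := by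
    intro I' u hu
    simp only [RegularMod, not_forall] at hu
    obtain ⟨r, hr, hr'⟩ := hu
    have : u ∈ ⋃ p ∈ associatedPrimes B (B ⧸ I'), (p : Set B) := by
      rw [biUnion_associatedPrimes_eq_zero_divisors]
      refine ⟨Ideal.Quotient.mk I' r, by rwa [Ne, Ideal.Quotient.eq_zero_iff_mem], ?_⟩
      rwa [Algebra.smul_def, Ideal.Quotient.algebraMap_eq, ← map_mul,
        Ideal.Quotient.eq_zero_iff_mem]
    simpa using this
  have hsub : (maximalIdeal B : Set B) ⊆ ⋃ q ∈ s, (id q : Ideal B) := by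
    intro u hu
    by_cases h : RegularMod I u
    · obtain ⟨q, hq, huq⟩ := hnr J u (hcon u hu h)
      exact Set.mem_biUnion (Or.inr hq) huq
    · obtain ⟨q, hq, huq⟩ := hnr I u h
      exact Set.mem_biUnion (Or.inl hq) huq
  obtain ⟨q, hq, hle⟩ := (Ideal.subset_union_prime_finite hs (f := id) ⊤ ⊤
    (fun q hq _ _ ↦ hprime q hq)).1 hsub
  have hqm : maximalIdeal B = q :=
    (maximalIdeal.isMaximal B).eq_of_le (hprime q hq).ne_top hle
  rcases hq with h | h
  · exact hI (hsoc I (hqm ▸ h))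
  · exact hJ (hsoc J (hqm ▸ h))

/-- In a local domain in which the length of regular sequences exceeds two, an associated prime of
a principal ideal is not immediately below the maximal ideal. -/
lemma not_covBy_maximalIdeal_of_colon [IsLocalRing B] [IsNoetherianRing B] [IsDomain B]
    {x₁ x₂ b g : B} (hx₁ : x₁ ≠ 0) (hx₁m : x₁ ∈ maximalIdeal B) (hx₂m : x₂ ∈ maximalIdeal B)
    (hx₂ : RegularMod (Ideal.span {x₁}) x₂)
    (hsoc : ¬ HasSocle (Ideal.span {x₁} ⊔ Ideal.span {x₂})) (hb : b ≠ 0)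
    (hbsoc : ¬ HasSocle (Ideal.span {b})) {p : Ideal B} (hp : p.IsPrime)
    (hpg : ∀ r, r ∈ p ↔ r * g ∈ Ideal.span {b}) :
    ∃ q : Ideal B, q.IsPrime ∧ p < q ∧ q < maximalIdeal B := by
  by_contra! hcon
  have hgb : g ∉ Ideal.span {b} := fun h ↦ hp.ne_top (by
    rw [Ideal.eq_top_iff_one, hpg, one_mul]; exact h)
  have hx₁soc : ¬ HasSocle (Ideal.span {x₁}) := fun h ↦ h.not_regularMod hx₂m hx₂
  obtain ⟨u, hum, hub, hux⟩ := exists_regularMod hbsoc hx₁soc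
  have hup : u ∉ p := fun h ↦ hgb (hub g ((hpg u).1 h))
  -- `N / (b)` is the part of `B / (b)` killed by `p`; it is nonzero because it contains the class
  -- of `g`.
  let N : Ideal B :=
    { carrier := {n | ∀ r ∈ p, r * n ∈ Ideal.span {b}}
      add_mem' := fun ha hb r hr ↦ by rw [mul_add]; exact add_mem (ha r hr) (hb r hr)
      zero_mem' := fun r _ ↦ by simp
      smul_mem' := fun c n hn r hr ↦ by
        rw [smul_eq_mul, mul_left_comm]; exact Ideal.mul_mem_left _ _ (hn r hr) }
  have hbN : Ideal.span {b} ≤ N := fun n hn r _ ↦ Ideal.mul_mem_left _ _ hn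
  have hgN : g ∈ N := fun r hr ↦ (hpg r).1 hr
  -- Were `N` inside `(u, b)`, regularity of `u` modulo `b` would give `N = (b) + u N`, so `N = (b)`
  -- by Nakayama. An `n` outside `(u, b)` is killed modulo `(u, b)` by `p + (u)`, which leads to an
  -- associated prime strictly above `p`.
  have : ∃ n ∈ N, n ∉ Ideal.span {u} ⊔ Ideal.span {b} := by
    by_contra! hle
    have h1 : N ≤ Ideal.span {b} ⊔ (Ideal.span {u}) • N := by
      intro n hn
      obtain ⟨y, hy, z, hz, hyz⟩ := Submodule.mem_sup.1 (hle n hn)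
      obtain ⟨c, rfl⟩ := Ideal.mem_span_singleton'.1 hy
      have hc : c ∈ N := by
        intro r hr
        apply hub
        have : u * (r * c) = r * n - r * z := by rw [← hyz]; ring
        rw [this]
        exact sub_mem (hn r hr) (Ideal.mul_mem_left _ _ hz)
      refine Submodule.mem_sup.2 ⟨z, hz, c * u, ?_, by rw [← hyz]; ring⟩
      rw [mul_comm]
      exact Submodule.smul_mem_smul (Ideal.mem_span_singleton_self u) hc
    have h2 := Submodule.le_of_le_smul_of_le_jacobson_bot (IsNoetherian.noetherian N)
      (by
        rw [IsLocalRing.jacobson_eq_maximalIdeal _ bot_ne_top, Ideal.span_singleton_le_iff_mem]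
        exact hum) h1
    exact hgb (h2 hgN)
  obtain ⟨n, hnN, hn⟩ := this
  obtain ⟨q, hq, hle, g', hg'⟩ := exists_prime_colon (I := p ⊔ Ideal.span {u}) hn (by
    intro r hr
    obtain ⟨y, hy, z, hz, rfl⟩ := Submodule.mem_sup.1 hr
    rw [add_mul]
    exact add_mem (Submodule.mem_sup_right (hnN y hy))
      (Submodule.mem_sup_left (Ideal.mul_mem_right _ _ hz)))
  have hpq : p < q := lt_of_le_of_ne (le_sup_left.trans hle) fun h ↦ hup
    (h ▸ hle (Submodule.mem_sup_right (Ideal.mem_span_singleton_self u)))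
  have hqm : q = maximalIdeal B := by
    by_contra hne
    exact hcon q hq hpq (lt_of_le_of_ne (le_maximalIdeal hq.ne_top) hne)
  have hs1 : HasSocle (Ideal.span {u} ⊔ Ideal.span {b}) :=
    ⟨g', fun h ↦ hq.ne_top (by rw [Ideal.eq_top_iff_one, hg', one_mul]; exact h),
      fun r hr ↦ (hg' r).1 (hqm ▸ hr)⟩
  -- Replace `b` by `x₁` modulo `u`, then `u` by `x₂` modulo `x₁`.
  have hs2 := hs1.exchange (hub.swap hb) (hux.swap hx₁) hx₁m
  rw [sup_comm] at hs2
  exact hsoc (hs2.exchange hux hx₂ hx₂m)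

end LocalSocle

/-! ### Regular local rings: domains, regular sequences, depth -/

section RegularLocal

open IsLocalRing

/-- An element outside the square of the maximal ideal is part of a minimal generating set. -/
lemma IsLocalRing.spanFinrank_maximalIdeal_quotient_span_singleton_lt {B : Type*} [CommRing B]
    [IsLocalRing B] [IsNoetherianRing B] {x : B} (hx : x ∈ maximalIdeal B)
    (hx2 : x ∉ maximalIdeal B ^ 2) [IsLocalRing (B ⧸ Ideal.span {x})] :
    (maximalIdeal (B ⧸ Ideal.span {x})).spanFinrank + 1 ≤ (maximalIdeal B).spanFinrank := by
  classical
  obtain ⟨s, hcard, hs⟩ := Submodule.FG.exists_span_finset_card_eq_spanFinrank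
    (IsNoetherian.noetherian (maximalIdeal B))
  have hx' : x ∈ Submodule.span B (s : Set B) := hs ▸ hx
  obtain ⟨c, hc⟩ := Submodule.mem_span_finset'.1 hx'
  have : ∃ j : s, c j ∉ maximalIdeal B := by
    by_contra! h
    refine hx2 (hc ▸ sum_mem fun j _ ↦ ?_)
    rw [pow_two]
    exact Ideal.mul_mem_mul (h j) (hs ▸ Submodule.subset_span j.2)
  obtain ⟨j, hj⟩ := this
  have hju : IsUnit (c j) := by simpa using hj
  have hmap : maximalIdeal (B ⧸ Ideal.span {x}) =
      (maximalIdeal B).map (Ideal.Quotient.mk (Ideal.span {x})) :=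
    (map_maximalIdeal_of_surjective _ Ideal.Quotient.mk_surjective).symm
  have key : maximalIdeal (B ⧸ Ideal.span {x}) =
      Submodule.span _ ((s.erase j).image (Ideal.Quotient.mk (Ideal.span {x})) : Set _) := by
    rw [hmap, ← hs]
    change Ideal.map _ (Ideal.span _) = Ideal.span _
    rw [Ideal.map_span]
    apply le_antisymm
    · rw [Ideal.span_le]
      rintro _ ⟨y, hy, rfl⟩
      by_cases hyj : y = j
      · subst hyj
        rw [SetLike.mem_coe, ← Ideal.unit_mul_mem_iff_mem _ (hju.map (Ideal.Quotient.mk _)),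
          ← map_mul]
        have h0 : Ideal.Quotient.mk (Ideal.span {x}) x = 0 := by
          rw [Ideal.Quotient.eq_zero_iff_mem]; exact Ideal.mem_span_singleton_self x
        replace h0 := (congrArg (Ideal.Quotient.mk (Ideal.span {x})) hc).trans h0
        rw [← Finset.add_sum_erase _ _ (Finset.mem_univ j), map_add, smul_eq_mul] at h0
        rw [eq_neg_of_add_eq_zero_left h0]
        refine neg_mem ?_
        rw [map_sum]
        refine sum_mem fun i hi ↦ ?_
        rw [smul_eq_mul, map_mul]
        refine Ideal.mul_mem_left _ _ (Ideal.subset_span ?_)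
        simp only [Finset.coe_image, Finset.coe_erase]
        exact ⟨i, ⟨i.2, fun h ↦ (Finset.mem_erase.1 hi).1 (Subtype.ext h)⟩, rfl⟩
      · refine Ideal.subset_span ?_
        simp only [Finset.coe_image, Finset.coe_erase]
        exact ⟨y, ⟨hy, hyj⟩, rfl⟩
    · refine Ideal.span_mono ?_
      simp only [Finset.coe_image, Finset.coe_erase]
      exact Set.image_mono Set.sdiff_subset
  have h1 := Submodule.spanFinrank_span_le_ncard_of_finite (R := B ⧸ Ideal.span {x})
    (Finset.finite_toSet ((s.erase (j : B)).image (Ideal.Quotient.mk (Ideal.span {x}))))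
  rw [← key, Set.ncard_coe_finset] at h1
  have h2 := Finset.card_image_le (s := s.erase (j : B)) (f := Ideal.Quotient.mk (Ideal.span {x}))
  have h3 := Finset.card_erase_add_one j.2
  omega

/-- Passing to the quotient lowers the embedding dimension by at least one and the Krull dimension
by at most one. Since the two agree for `B`, and dimension never exceeds embedding dimension, both
drop by exactly one. -/
lemma IsRegularLocalRing.quotient_span_singleton {B : Type*} [CommRing B] [IsRegularLocalRing B]
    {x : B} (hx : x ∈ maximalIdeal B) (hx2 : x ∉ maximalIdeal B ^ 2) :
    ∃ _ : IsRegularLocalRing (B ⧸ Ideal.span {x}),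
      (maximalIdeal (B ⧸ Ideal.span {x})).spanFinrank + 1 = (maximalIdeal B).spanFinrank := by
  have : Nontrivial (B ⧸ Ideal.span {x}) := Ideal.Quotient.nontrivial_iff.2 fun h ↦
    (maximalIdeal.isMaximal B).ne_top (top_unique (h ▸ (Ideal.span_singleton_le_iff_mem _).2 hx))
  have : IsLocalRing (B ⧸ Ideal.span {x}) :=
    .of_surjective' (Ideal.Quotient.mk _) Ideal.Quotient.mk_surjective
  have h1 := spanFinrank_maximalIdeal_quotient_span_singleton_lt hx hx2
  have h2 : ringKrullDim B ≤ ringKrullDim (B ⧸ Ideal.span {x}) + 1 := by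
    have := ringKrullDim_le_ringKrullDim_quotient_add_encard (R := B) {x}
      (by simpa [ringJacobson_eq_maximalIdeal] using hx)
    rwa [Set.encard_singleton] at this
  rw [← IsRegularLocalRing.spanFinrank_maximalIdeal (R := B)] at h2
  have h3 := ringKrullDim_le_spanFinrank_maximalIdeal (B ⧸ Ideal.span {x})
  have h4 : ((maximalIdeal B).spanFinrank : WithBot ℕ∞) ≤
      ((maximalIdeal (B ⧸ Ideal.span {x})).spanFinrank + 1 : ℕ) := by
    refine h2.trans ?_
    push_cast
    gcongr
  have h5 : (maximalIdeal B).spanFinrank ≤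
      (maximalIdeal (B ⧸ Ideal.span {x})).spanFinrank + 1 := by exact_mod_cast h4
  refine ⟨.of_spanFinrank_maximalIdeal_le _ ?_, by omega⟩
  have h6 : (((maximalIdeal (B ⧸ Ideal.span {x})).spanFinrank : ℕ) : WithBot ℕ∞) + 1 ≤
      ringKrullDim (B ⧸ Ideal.span {x}) + 1 := by
    refine le_trans ?_ h2
    exact_mod_cast h1
  have hne : ringKrullDim (B ⧸ Ideal.span {x}) ≠ ⊥ := ringKrullDim_ne_bot
  obtain ⟨d, hd⟩ := WithBot.ne_bot_iff_exists.1 hne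
  rw [← hd] at h6 ⊢
  have h7 : (((maximalIdeal (B ⧸ Ideal.span {x})).spanFinrank : ℕ) : ℕ∞) + 1 ≤ d + 1 := by
    exact_mod_cast h6
  have h8 := (ENat.add_le_add_iff_right (by simp)).1 h7
  exact_mod_cast h8

lemma IsLocalRing.maximalIdeal_pow_two_lt {B : Type*} [CommRing B] [IsLocalRing B]
    [IsNoetherianRing B] (h : maximalIdeal B ≠ ⊥) : ¬ maximalIdeal B ≤ maximalIdeal B ^ 2 := by
  intro hle
  refine h (Submodule.eq_bot_of_le_smul_of_le_jacobson_bot _ _ (IsNoetherian.noetherian _)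
    (hle.trans_eq (pow_two _)) ?_)
  rw [IsLocalRing.jacobson_eq_maximalIdeal _ bot_ne_top]

/-- Induction on the embedding dimension: cut by an `x` outside the square of the maximal ideal and
outside all minimal primes. The ideal `(x)` is then prime, and a minimal prime `q ⊆ (x)` satisfies
`q = x q`, so `q = 0` by Nakayama. -/
theorem IsRegularLocalRing.isDomain (B : Type*) [CommRing B] [h : IsRegularLocalRing B] :
    IsDomain B := by
  obtain ⟨n, hn⟩ : ∃ n, (maximalIdeal B).spanFinrank = n := ⟨_, rfl⟩
  induction n generalizing B with
  | zero =>
    rw [Submodule.spanFinrank_eq_zero_iff_eq_bot (IsNoetherian.noetherian _)] at hn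
    exact ((isField_iff_maximalIdeal_eq).2 hn).isDomain
  | succ n ih =>
    have hbot : maximalIdeal B ≠ ⊥ := fun h ↦ by
      rw [h, Submodule.spanFinrank_bot] at hn; omega
    have hfin : (minimalPrimes B).Finite := minimalPrimes.finite_of_isNoetherianRing B
    have hmin : maximalIdeal B ∉ minimalPrimes B := by
      intro hm
      have h1 : ringKrullDim B = (n + 1 : ℕ) := by
        rw [← h.spanFinrank_maximalIdeal, hn]
      rw [← IsLocalRing.maximalIdeal_height_eq_ringKrullDim,
        show (maximalIdeal B).height = 0 from Ideal.height_eq_zero_iff.2 hm] at h1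
      have h2 : (0 : ℕ∞) = (n + 1 : ℕ) := by exact_mod_cast h1
      have h3 : 0 = n + 1 := by exact_mod_cast h2
      omega
    -- Prime avoidance tolerates non-prime ideals in up to two places, so the square of the maximal
    -- ideal may be avoided along with the minimal primes.
    have : ¬ (maximalIdeal B : Set B) ⊆
        ⋃ q ∈ insert (maximalIdeal B ^ 2) (minimalPrimes B), (id q : Ideal B) := by
      rw [Ideal.subset_union_prime_finite (hfin.insert _) (maximalIdeal B ^ 2) (maximalIdeal B ^ 2)
        (by
          rintro q (rfl | hq) h1 _
          · exact absurd rfl h1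
          · exact hq.1.1)]
      rintro ⟨q, rfl | hq, hle⟩
      · exact maximalIdeal_pow_two_lt hbot hle
      · exact hmin ((maximalIdeal.isMaximal B).eq_of_le hq.1.1.ne_top hle ▸ hq)
    obtain ⟨x, hxm, hx⟩ := Set.not_subset.1 this
    simp only [Set.mem_insert_iff, id_eq, Set.iUnion_iUnion_eq_or_left, Set.mem_union,
      SetLike.mem_coe, Set.mem_iUnion, exists_prop, not_or, not_exists, not_and] at hx
    obtain ⟨hreg, hrank⟩ := quotient_span_singleton hxm hx.1
    have := ih (B ⧸ Ideal.span {x}) (by omega)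
    have hxp : (Ideal.span {x}).IsPrime := (Ideal.Quotient.isDomain_iff_prime _).1 this
    obtain ⟨q, hq, hqx⟩ := Ideal.exists_minimalPrimes_le (I := ⊥) (J := Ideal.span {x}) bot_le
    have hxq := hx.2 q hq
    have hqle : q ≤ Ideal.span {x} • q := by
      intro y hy
      obtain ⟨c, rfl⟩ := Ideal.mem_span_singleton'.1 (hqx hy)
      rw [mul_comm]
      exact Submodule.smul_mem_smul (Ideal.mem_span_singleton_self x)
        ((hq.1.1.mem_or_mem hy).resolve_right hxq)
    have hq0 := Submodule.eq_bot_of_le_smul_of_le_jacobson_bot _ _ (IsNoetherian.noetherian _) hqle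
      (by rw [IsLocalRing.jacobson_eq_maximalIdeal _ bot_ne_top,
            Ideal.span_singleton_le_iff_mem]; exact hxm)
    subst hq0
    have : Nontrivial B := inferInstance
    have := hq.1.1
    exact IsDomain.of_bot_isPrime B

/-- A regular local ring of dimension at least two has a regular sequence of length two, which
generates the maximal ideal in dimension two and can be prolonged in higher dimension. -/
lemma IsRegularLocalRing.exists_regular_pair (B : Type*) [CommRing B] [IsRegularLocalRing B]
    (h : 2 ≤ (maximalIdeal B).spanFinrank) :
    ∃ x₁ ∈ maximalIdeal B, ∃ x₂ ∈ maximalIdeal B, x₁ ≠ 0 ∧ RegularMod (Ideal.span {x₁}) x₂ ∧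
      ((maximalIdeal B).spanFinrank = 2 → maximalIdeal B = Ideal.span {x₁, x₂}) ∧
      (3 ≤ (maximalIdeal B).spanFinrank →
        ¬ HasSocle (Ideal.span {x₁} ⊔ Ideal.span {x₂})) := by
  have hB : maximalIdeal B ≠ ⊥ := fun h0 ↦ by
    have h1 := congrArg Submodule.spanFinrank h0
    rw [Submodule.spanFinrank_bot] at h1
    omega
  obtain ⟨x₁, hx₁, hx₁'⟩ := SetLike.not_le_iff_exists.1 (maximalIdeal_pow_two_lt hB)
  obtain ⟨hreg, hrank⟩ := quotient_span_singleton hx₁ hx₁'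
  have hdom := IsRegularLocalRing.isDomain (B ⧸ Ideal.span {x₁})
  have hB₁ : maximalIdeal (B ⧸ Ideal.span {x₁}) ≠ ⊥ := fun h0 ↦ by
    have h1 := congrArg Submodule.spanFinrank h0
    rw [Submodule.spanFinrank_bot] at h1
    omega
  obtain ⟨y, hy, hy'⟩ := SetLike.not_le_iff_exists.1 (maximalIdeal_pow_two_lt hB₁)
  obtain ⟨hreg₂, hrank₂⟩ := quotient_span_singleton hy hy'
  have hdom₂ := IsRegularLocalRing.isDomain ((B ⧸ Ideal.span {x₁}) ⧸ Ideal.span {y})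
  obtain ⟨x₂, rfl⟩ := Ideal.Quotient.mk_surjective y
  have hmap : maximalIdeal (B ⧸ Ideal.span {x₁}) =
      (maximalIdeal B).map (Ideal.Quotient.mk (Ideal.span {x₁})) :=
    (map_maximalIdeal_of_surjective _ Ideal.Quotient.mk_surjective).symm
  have hcomap : ∀ z, Ideal.Quotient.mk (Ideal.span {x₁}) z ∈
      maximalIdeal (B ⧸ Ideal.span {x₁}) ↔ z ∈ maximalIdeal B := by
    intro z
    rw [hmap, Ideal.mem_quotient_iff_mem_sup, sup_eq_left.2]
    rwa [Ideal.span_singleton_le_iff_mem]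
  have hspan : ∀ z, Ideal.Quotient.mk (Ideal.span {x₁}) z ∈
      Ideal.span {Ideal.Quotient.mk (Ideal.span {x₁}) x₂} ↔
      z ∈ Ideal.span {x₁} ⊔ Ideal.span {x₂} := by
    intro z
    have := Ideal.mem_quotient_iff_mem_sup (I := Ideal.span {x₁}) (J := Ideal.span {x₂}) (x := z)
    rw [Ideal.map_span, Set.image_singleton] at this
    rw [this, sup_comm]
  refine ⟨x₁, hx₁, x₂, (hcomap _).1 hy, fun h ↦ hx₁' (h ▸ zero_mem _), ?_, ?_, ?_⟩
  · intro r hr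
    rw [← Ideal.Quotient.eq_zero_iff_mem, map_mul, mul_eq_zero,
      Ideal.Quotient.eq_zero_iff_mem, Ideal.Quotient.eq_zero_iff_mem] at hr
    refine hr.resolve_left fun h ↦ hy' ?_
    rw [Ideal.Quotient.eq_zero_iff_mem.2 h]
    exact zero_mem _
  · intro h2
    have h0 : maximalIdeal ((B ⧸ Ideal.span {x₁}) ⧸
        Ideal.span {Ideal.Quotient.mk (Ideal.span {x₁}) x₂}) = ⊥ :=
      (Submodule.spanFinrank_eq_zero_iff_eq_bot (IsNoetherian.noetherian _)).1 (by omega)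
    rw [← map_maximalIdeal_of_surjective _ Ideal.Quotient.mk_surjective,
      Ideal.map_eq_bot_iff_le_ker,
      Ideal.mk_ker] at h0
    rw [Ideal.span_insert]
    refine le_antisymm (fun z hz ↦ (hspan z).1 (h0 ((hcomap z).2 hz))) (sup_le ?_ ?_)
    · rwa [Ideal.span_singleton_le_iff_mem]
    · rw [Ideal.span_singleton_le_iff_mem]; exact (hcomap _).1 hy
  · intro h3 ⟨g, hg, hm⟩
    have hB₂ : maximalIdeal ((B ⧸ Ideal.span {x₁}) ⧸
        Ideal.span {Ideal.Quotient.mk (Ideal.span {x₁}) x₂}) ≠ ⊥ := fun h0 ↦ by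
      have h1 := congrArg Submodule.spanFinrank h0
      rw [Submodule.spanFinrank_bot] at h1
      omega
    obtain ⟨w, hw, hw0⟩ := Submodule.exists_mem_ne_zero_of_ne_bot hB₂
    obtain ⟨w, rfl⟩ := Ideal.Quotient.mk_surjective w
    obtain ⟨w, rfl⟩ := Ideal.Quotient.mk_surjective w
    have hwm : w ∈ maximalIdeal B := by
      by_contra hcon
      have : IsUnit w := by simpa using hcon
      exact hw ((this.map _).map _)
    have := hm w hwm
    rw [← hspan, ← Ideal.Quotient.eq_zero_iff_mem, map_mul, map_mul, mul_eq_zero] at this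
    rcases this with h | h
    · exact hw0 h
    · rw [Ideal.Quotient.eq_zero_iff_mem, hspan] at h
      exact hg h

/-- Depth at least two: in a regular local ring of dimension at least two, the maximal ideal is
not associated to a principal ideal. -/
lemma IsRegularLocalRing.not_hasSocle_span_singleton {B : Type*} [CommRing B]
    [IsRegularLocalRing B] (h : 2 ≤ (maximalIdeal B).spanFinrank) {b : B} (hb : b ≠ 0) :
    ¬ HasSocle (Ideal.span {b}) := by
  intro hs
  have := IsRegularLocalRing.isDomain B
  obtain ⟨x₁, hx₁, x₂, hx₂, hne, hreg, -⟩ := exists_regular_pair B h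
  have hr : ∀ t : B, t ≠ 0 → RegularMod ⊥ t := by
    intro t ht r hr
    simpa [ht] using hr
  rw [← bot_sup_eq (Ideal.span {b})] at hs
  -- A socle modulo `b` would transfer to a socle modulo `x₁`, but `x₂` is regular there.
  have := hs.exchange (hr b hb) (hr x₁ hne) hx₁
  rw [bot_sup_eq] at this
  exact this.not_regularMod hx₂ hreg

/-- A prime ideal associated to a nonzero principal ideal of a regular local ring of dimension at
least three is not immediately below the maximal ideal. -/
lemma IsRegularLocalRing.exists_prime_between {B : Type*} [CommRing B]
    [IsRegularLocalRing B] (h : 3 ≤ (maximalIdeal B).spanFinrank) {b g : B} (hb : b ≠ 0)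
    {p : Ideal B} (hp : p.IsPrime) (hpg : ∀ r, r ∈ p ↔ r * g ∈ Ideal.span {b}) :
    ∃ q : Ideal B, q.IsPrime ∧ p < q ∧ q < maximalIdeal B := by
  have := IsRegularLocalRing.isDomain B
  obtain ⟨x₁, hx₁, x₂, hx₂, hne, hreg, -, hsoc⟩ := exists_regular_pair B (by omega)
  exact not_covBy_maximalIdeal_of_colon hne hx₁ hx₂ hreg (hsoc h) hb
    (not_hasSocle_span_singleton (by omega) hb) hp hpg

/-- A regular local ring of dimension at most one is a principal ideal domain. -/
lemma IsRegularLocalRing.isPrincipalIdealRing_of_le_one {B : Type*} [CommRing B]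
    [IsRegularLocalRing B] (h : (maximalIdeal B).spanFinrank ≤ 1) : IsPrincipalIdealRing B := by
  have := IsRegularLocalRing.isDomain B
  have hp : (maximalIdeal B).IsPrincipal := by
    by_cases h0 : maximalIdeal B = ⊥
    · rw [h0]; infer_instance
    · refine ((Submodule.spanFinrank_eq_one_iff _).1 ?_).1
      have := (Submodule.spanFinrank_eq_zero_iff_eq_bot
        (IsNoetherian.noetherian (maximalIdeal B))).not.2 h0
      omega
  exact ((tfae_of_isNoetherianRing_of_isLocalRing_of_isDomain B).out 0 4).2 hp

end RegularLocal

end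

/-! ### Two-dimensional regular local rings through a regular pair of generators -/

section

open IsLocalRing Polynomial

lemma IsLocalRing.isDomain_of_isPrime_span_singleton {B : Type*} [CommRing B] [IsLocalRing B]
    [IsNoetherianRing B] {x : B} (hxm : x ∈ maximalIdeal B) (hxp : (Ideal.span {x}).IsPrime)
    (hx : ∀ q ∈ minimalPrimes B, x ∉ q) : IsDomain B := by
  obtain ⟨q, hq, hqx⟩ := Ideal.exists_minimalPrimes_le (I := ⊥) (J := Ideal.span {x}) bot_le
  have hqle : q ≤ Ideal.span {x} • q := by
    intro y hy
    obtain ⟨c, rfl⟩ := Ideal.mem_span_singleton'.1 (hqx hy)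
    rw [mul_comm]
    exact Submodule.smul_mem_smul (Ideal.mem_span_singleton_self x)
      ((hq.1.1.mem_or_mem hy).resolve_right (hx q hq))
  have hq0 := Submodule.eq_bot_of_le_smul_of_le_jacobson_bot _ _ (IsNoetherian.noetherian _) hqle
    (by rw [IsLocalRing.jacobson_eq_maximalIdeal _ bot_ne_top,
          Ideal.span_singleton_le_iff_mem]; exact hxm)
  subst hq0
  have := hq.1.1
  exact IsDomain.of_bot_isPrime B

/-- The maximal ideal of the local ring `A` is generated by a regular sequence of length two. -/
def HasRegularPair (A : Type*) [CommRing A] [IsLocalRing A] : Prop :=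
  ∃ s t : A, maximalIdeal A = Ideal.span {s, t} ∧ RegularMod ⊥ s ∧ RegularMod (Ideal.span {s}) t

lemma RegularMod.notMem_of_mem_minimalPrimes {B : Type*} [CommRing B] {x : B}
    (hx : RegularMod ⊥ x) {q : Ideal B} (hq : q ∈ minimalPrimes B) : x ∉ q := fun h ↦
  Set.disjoint_left.1 (Ideal.disjoint_nonZeroDivisors_of_mem_minimalPrimes hq) h
    (mem_nonZeroDivisors_iff_right.2 fun r hr ↦ by simpa using hx r (by simpa [mul_comm] using hr))

/-- The equational criterion of flatness turns the relation `t * r - s * c = 0` over `A'` into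
finitely many relations over `A`, where regularity of `t` modulo `s` applies. -/
lemma RegularMod.of_flat {A A' : Type*} [CommRing A] [CommRing A'] [Algebra A A']
    [Module.Flat A A'] {s t : A} (h : RegularMod (Ideal.span {s}) t) :
    RegularMod (Ideal.span {algebraMap A A' s}) (algebraMap A A' t) := by
  intro r hr
  obtain ⟨c, hc⟩ := Ideal.mem_span_singleton'.1 hr
  obtain ⟨κ, a, y, h1, h2⟩ := Module.Flat.isTrivialRelation_of_sum_smul_eq_zero
    (R := A) (M := A') (f := ![t, -s]) (x := ![r, c]) (by
      simp only [Fin.sum_univ_two, Matrix.cons_val_zero, Matrix.cons_val_one, Algebra.smul_def,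
        map_neg, ← hc]
      ring)
  have hr' : r = ∑ j, a 0 j • y j := h1 0
  rw [hr']
  refine sum_mem fun j _ ↦ ?_
  have h3 := h2 j
  simp only [Fin.sum_univ_two, Matrix.cons_val_zero, Matrix.cons_val_one] at h3
  have h4 : a 0 j ∈ Ideal.span {s} := h _ (Ideal.mem_span_singleton'.2 ⟨a 1 j, by
    linear_combination -h3⟩)
  obtain ⟨d, hd⟩ := Ideal.mem_span_singleton'.1 h4
  rw [Algebra.smul_def, ← hd, map_mul]
  exact Ideal.mul_mem_right _ _ (Ideal.mul_mem_left _ _ (Ideal.mem_span_singleton_self _))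

namespace HasRegularPair

variable {A : Type*} [CommRing A] [IsLocalRing A] [IsNoetherianRing A]

/-- The maximal ideal of the quotient is generated by the image of `t`, which is a non-zero-divisor.
-/
lemma isPrincipalIdealRing_quotient {s t : A} (h : maximalIdeal A = Ideal.span {s, t})
    (ht : RegularMod (Ideal.span {s}) t) :
    IsDomain (A ⧸ Ideal.span {s}) ∧ IsPrincipalIdealRing (A ⧸ Ideal.span {s}) := by
  have hsm : s ∈ maximalIdeal A := h ▸ Ideal.subset_span (by simp)
  have htm : t ∈ maximalIdeal A := h ▸ Ideal.subset_span (by simp)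
  have : Nontrivial (A ⧸ Ideal.span {s}) := Ideal.Quotient.nontrivial_iff.2 fun h ↦
    (maximalIdeal.isMaximal A).ne_top (top_unique (h ▸ (Ideal.span_singleton_le_iff_mem _).2 hsm))
  have : IsLocalRing (A ⧸ Ideal.span {s}) :=
    .of_surjective' (Ideal.Quotient.mk _) Ideal.Quotient.mk_surjective
  have hs0 : Ideal.Quotient.mk (Ideal.span {s}) s = 0 :=
    Ideal.Quotient.eq_zero_iff_mem.2 (Ideal.mem_span_singleton_self s)
  have hmax : maximalIdeal (A ⧸ Ideal.span {s}) =
      Ideal.span {Ideal.Quotient.mk (Ideal.span {s}) t} := by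
    rw [← map_maximalIdeal_of_surjective _ Ideal.Quotient.mk_surjective, h, Ideal.map_span,
      Set.image_pair, hs0, Ideal.span_insert, Ideal.span_singleton_eq_bot.2 rfl, bot_sup_eq]
  have hreg : RegularMod ⊥ (Ideal.Quotient.mk (Ideal.span {s}) t) := by
    intro r hr
    obtain ⟨r, rfl⟩ := Ideal.Quotient.mk_surjective r
    rw [Ideal.mem_bot, ← map_mul, Ideal.Quotient.eq_zero_iff_mem] at hr
    rw [Ideal.mem_bot, Ideal.Quotient.eq_zero_iff_mem]
    exact ht r hr
  have hdom : IsDomain (A ⧸ Ideal.span {s}) :=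
    isDomain_of_isPrime_span_singleton (hmax ▸ Ideal.mem_span_singleton_self _)
      (hmax ▸ (maximalIdeal.isMaximal _).isPrime) fun q hq ↦ hreg.notMem_of_mem_minimalPrimes hq
  exact ⟨hdom, ((tfae_of_isNoetherianRing_of_isLocalRing_of_isDomain _).out 0 4).2
    (show (maximalIdeal (A ⧸ Ideal.span {s})).IsPrincipal from ⟨_, hmax⟩)⟩

lemma isDomain (h : HasRegularPair A) : IsDomain A := by
  obtain ⟨s, t, hm, hs, ht⟩ := h
  have := (isPrincipalIdealRing_quotient hm ht).1
  exact isDomain_of_isPrime_span_singleton (hm ▸ Ideal.subset_span (by simp))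
    ((Ideal.Quotient.isDomain_iff_prime _).1 this) fun q hq ↦ hs.notMem_of_mem_minimalPrimes hq

/-- If `s ∈ p`, the image of `p` in the principal ideal domain `A / (s)` is a non-maximal prime,
hence zero, and `p = (s)`. If `s ∉ p`, then `p ∩ (s) = s p`; lifting a generator of the image to `f
∈ p` gives `p = (f) + s p`, and Nakayama gives `p = (f)`. -/
lemma isPrincipal_of_ne_maximalIdeal [IsDomain A] (h : HasRegularPair A) {p : Ideal A}
    (hp : p.IsPrime) (hpm : p ≠ maximalIdeal A) : p.IsPrincipal := by
  obtain ⟨s, t, hm, hs, ht⟩ := h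
  obtain ⟨hdom, hpir⟩ := isPrincipalIdealRing_quotient hm ht
  have hsm : s ∈ maximalIdeal A := hm ▸ Ideal.subset_span (by simp)
  by_cases hsp : s ∈ p
  · refine ⟨s, le_antisymm (fun z hz ↦ ?_) ((Ideal.span_singleton_le_iff_mem _).2 hsp)⟩
    by_contra hzs
    have hcomap : (p.map (Ideal.Quotient.mk (Ideal.span {s}))).comap
        (Ideal.Quotient.mk (Ideal.span {s})) = p := by
      rw [Ideal.comap_map_of_surjective _ Ideal.Quotient.mk_surjective, ← RingHom.ker_eq_comap_bot,
        Ideal.mk_ker, sup_eq_left, Ideal.span_singleton_le_iff_mem]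
      exact hsp
    have hp' : (p.map (Ideal.Quotient.mk (Ideal.span {s}))).IsPrime :=
      Ideal.isPrime_map_quotientMk_of_isPrime ((Ideal.span_singleton_le_iff_mem _).2 hsp)
    have hmax : (p.map (Ideal.Quotient.mk (Ideal.span {s}))).IsMaximal := hp'.isMaximal fun h0 ↦
      hzs (by
        have := Ideal.mem_map_of_mem (Ideal.Quotient.mk (Ideal.span {s})) hz
        rwa [h0, Ideal.mem_bot, Ideal.Quotient.eq_zero_iff_mem] at this)
    have := Ideal.comap_isMaximal_of_surjective (Ideal.Quotient.mk (Ideal.span {s}))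
      Ideal.Quotient.mk_surjective (K := p.map (Ideal.Quotient.mk (Ideal.span {s})))
    rw [hcomap] at this
    exact hpm (eq_maximalIdeal this)
  obtain ⟨y, hy⟩ := hpir.principal (p.map (Ideal.Quotient.mk (Ideal.span {s})))
  have hyp : y ∈ p.map (Ideal.Quotient.mk (Ideal.span {s})) :=
    hy ▸ Submodule.mem_span_singleton_self y
  obtain ⟨f, hf, rfl⟩ := (Ideal.mem_map_iff_of_surjective _ Ideal.Quotient.mk_surjective).1 hyp
  have hle : p ≤ Ideal.span {f} ⊔ Ideal.span {s} • p := by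
    intro z hz
    have hz' : Ideal.Quotient.mk (Ideal.span {s}) z ∈
        Ideal.span {Ideal.Quotient.mk (Ideal.span {s}) f} := by
      have := Ideal.mem_map_of_mem (Ideal.Quotient.mk (Ideal.span {s})) hz
      rwa [hy] at this
    obtain ⟨c, hc⟩ := Ideal.mem_span_singleton'.1 hz'
    obtain ⟨c, rfl⟩ := Ideal.Quotient.mk_surjective c
    rw [← map_mul, eq_comm, Ideal.Quotient.eq] at hc
    obtain ⟨d, hd⟩ := Ideal.mem_span_singleton'.1 hc
    have hdp : d * s ∈ p := hd ▸ sub_mem hz (p.mul_mem_left _ hf)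
    refine Submodule.mem_sup.2 ⟨c * f, Ideal.mul_mem_left _ _ (Ideal.mem_span_singleton_self f),
      s * d, Submodule.smul_mem_smul (Ideal.mem_span_singleton_self s)
        ((hp.mem_or_mem hdp).resolve_right hsp), ?_⟩
    rw [mul_comm s d, hd]; ring
  have hle' := Submodule.le_of_le_smul_of_le_jacobson_bot (IsNoetherian.noetherian p)
    (by rw [IsLocalRing.jacobson_eq_maximalIdeal _ bot_ne_top,
          Ideal.span_singleton_le_iff_mem]; exact hsm) hle
  exact ⟨f, le_antisymm hle' ((Ideal.span_singleton_le_iff_mem _).2 hf)⟩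

lemma exists_prime_span_singleton [IsDomain A] (h : HasRegularPair A) :
    ∃ s t : A, maximalIdeal A = Ideal.span {s, t} ∧ Prime s ∧ ¬ s ∣ t := by
  obtain ⟨s, t, hm, hs, ht⟩ := h
  obtain ⟨hdom, -⟩ := isPrincipalIdealRing_quotient hm ht
  have hs0 : s ≠ 0 := fun h0 ↦ one_ne_zero (α := A) (by simpa using hs 1 (by simp [h0]))
  have hs : Prime s :=
    (Ideal.span_singleton_prime hs0).1 ((Ideal.Quotient.isDomain_iff_prime _).1 hdom)
  refine ⟨s, t, hm, hs, fun h ↦ hs.not_isUnit ?_⟩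
  have := ht 1 (by rwa [mul_one, Ideal.mem_span_singleton])
  rwa [Ideal.mem_span_singleton, ← isUnit_iff_dvd_one] at this

/-- Kaplansky's criterion asks for a prime element in every nonzero prime ideal. The maximal ideal
contains `s`, and every other prime is principal. -/
lemma uniqueFactorizationMonoid [IsDomain A] (h : HasRegularPair A) :
    UniqueFactorizationMonoid A := by
  obtain ⟨s, t, hm, hs, -⟩ := h.exists_prime_span_singleton
  rw [UniqueFactorizationMonoid.iff_exists_prime_mem_of_isPrime]
  intro p hp0 hp
  by_cases hpm : p = maximalIdeal A
  · exact ⟨s, hpm ▸ hm ▸ Ideal.subset_span (by simp), hs⟩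
  obtain ⟨f, hpf⟩ := h.isPrincipal_of_ne_maximalIdeal hp hpm
  change p = Ideal.span {f} at hpf
  have hf0 : f ≠ 0 := fun h0 ↦ hp0 (by rw [hpf, h0, Ideal.span_singleton_eq_bot])
  exact ⟨f, hpf ▸ Ideal.mem_span_singleton_self f, (Ideal.span_singleton_prime hf0).1 (hpf ▸ hp)⟩

/-- A non-maximal prime containing `a` and `b` is generated by a common divisor. The ideal-theoretic
form of coprimality is the one that can be carried along the local extensions below. -/
lemma isRelPrime_iff [IsDomain A] (h : HasRegularPair A) {a b : A} :
    IsRelPrime a b ↔ ∃ k, maximalIdeal A ^ k ≤ Ideal.span {a, b} := by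
  have hufd := h.uniqueFactorizationMonoid
  constructor
  · intro hab
    refine Ideal.exists_pow_le_of_le_radical_of_fg ?_ (IsNoetherian.noetherian _)
    rw [Ideal.radical_eq_sInf]
    refine le_sInf fun p ⟨hle, hp⟩ ↦ ?_
    by_contra hcon
    obtain ⟨f, hf⟩ := h.isPrincipal_of_ne_maximalIdeal hp fun h ↦ hcon h.ge
    change p = Ideal.span {f} at hf
    have hfu := hab (Ideal.mem_span_singleton.1 (hf ▸ hle (Ideal.subset_span (by simp))))
      (Ideal.mem_span_singleton.1 (hf ▸ hle (Ideal.subset_span (by simp))))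
    exact hp.ne_top (hf ▸ Ideal.span_singleton_eq_top.2 hfu)
  · rintro ⟨k, hk⟩ d hda hdb
    by_contra hd
    obtain ⟨s, t, hm, hs, hst⟩ := h.exists_prime_span_singleton
    have hle : ∀ z ∈ maximalIdeal A, d ∣ z ^ k := by
      intro z hz
      obtain ⟨x, y, hxy⟩ := Ideal.mem_span_pair.1 (hk (Ideal.pow_mem_pow hz k))
      rw [← hxy]
      exact dvd_add (hda.mul_left _) (hdb.mul_left _)
    have hsm : s ∈ maximalIdeal A := hm ▸ Ideal.subset_span (by simp)
    have htm : t ∈ maximalIdeal A := hm ▸ Ideal.subset_span (by simp)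
    have hd0 : d ≠ 0 := by
      rintro rfl
      exact pow_ne_zero k hs.ne_zero (zero_dvd_iff.1 (hle s hsm))
    obtain ⟨f, hf, hfd⟩ := WfDvdMonoid.exists_irreducible_factor hd hd0
    have hfp := hf.prime
    have hfs := hfp.dvd_of_dvd_pow (hfd.trans (hle s hsm))
    have hft := hfp.dvd_of_dvd_pow (hfd.trans (hle t htm))
    exact hst ((hfp.associated_of_dvd hs hfs).symm.dvd.trans hft)

lemma of_flat {A A' : Type*} [CommRing A] [IsLocalRing A] [CommRing A'] [IsLocalRing A']
    [Algebra A A'] [Module.Flat A A']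
    (hmap : (maximalIdeal A).map (algebraMap A A') = maximalIdeal A') (h : HasRegularPair A) :
    HasRegularPair A' := by
  obtain ⟨s, t, hm, hs, ht⟩ := h
  refine ⟨algebraMap A A' s, algebraMap A A' t, ?_, ?_, ?_⟩
  · rw [← hmap, hm, Ideal.map_span, Set.image_pair]
  · have := RegularMod.of_flat (A' := A') (s := 0) (t := s)
      (by rwa [Ideal.span_singleton_eq_bot.2 rfl])
    rwa [map_zero, Ideal.span_singleton_eq_bot.2 rfl] at this
  · exact ht.of_flat

end HasRegularPair

/-! ### Unramified flat local extensions that adjoin roots -/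

/-- Localize the standard étale algebra `A[X] / (f)` at the kernel of the map to an algebraic
closure of the residue field given by a root of the reduced polynomial. Unramifiedness makes the
maximal ideal of `A` generate that of `A'`. -/
lemma exists_flat_local_extension_root {A : Type u} [CommRing A] [IsLocalRing A]
    [IsNoetherianRing A] (f : A[X]) (hf : f.Monic) (hsep : f.Separable) (hdeg : f.natDegree ≠ 0) :
    ∃ (A' : Type u) (_ : CommRing A') (_ : IsLocalRing A') (_ : IsNoetherianRing A')
      (_ : Algebra A A') (_ : Module.Flat A A') (_ : IsLocalHom (algebraMap A A')),
      (maximalIdeal A).map (algebraMap A A') = maximalIdeal A' ∧ ∃ x : A', aeval x f = 0 := by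
  obtain ⟨a, b, hab⟩ := hsep
  let P : StandardEtalePair A := ⟨f, hf, 1, b, a, 0, by
    rw [pow_zero, ← hab]; ring⟩
  let κ := AlgebraicClosure (ResidueField A)
  obtain ⟨x, hx⟩ := IsAlgClosed.exists_aeval_eq_zero κ (f.map (algebraMap A (ResidueField A)))
    (by
      rw [hf.degree_map, Polynomial.degree_eq_natDegree hf.ne_zero]
      exact_mod_cast hdeg)
  have hmap : P.HasMap x := ⟨by rwa [aeval_map_algebraMap] at hx, by simp [P]⟩
  let φ : P.Ring →+* κ := (P.lift x hmap).toRingHom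
  let q := RingHom.ker φ
  have hq : q.IsPrime := RingHom.ker_isPrime φ
  have hφ : φ.comp (algebraMap A P.Ring) = algebraMap A κ := (P.lift x hmap).comp_algebraMap
  have hqm : q.comap (algebraMap A P.Ring) = maximalIdeal A := by
    rw [RingHom.comap_ker, hφ]
    ext y
    rw [RingHom.mem_ker, IsScalarTower.algebraMap_apply A (ResidueField A) κ, map_eq_zero]
    exact residue_eq_zero_iff y
  have : IsNoetherianRing P.Ring := Algebra.FiniteType.isNoetherianRing A _
  have : q.LiesOver (maximalIdeal A) := ⟨hqm.symm⟩
  have hloc : IsLocalHom (algebraMap A (Localization.AtPrime q)) := by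
    refine ⟨fun y hy ↦ ?_⟩
    by_contra hcon
    have h1 : algebraMap A P.Ring y ∈ q := by
      rw [← Ideal.mem_comap, hqm]; exact hcon
    rw [IsScalarTower.algebraMap_apply A P.Ring] at hy
    exact (IsLocalization.AtPrime.isUnit_to_map_iff _ q _).1 hy h1
  have : Module.Flat A P.Ring := inferInstance
  have : Module.Flat A (Localization.AtPrime q) := Module.Flat.trans A P.Ring _
  have : Algebra.FormallyUnramified A (Localization.AtPrime q) := .comp A P.Ring _
  have : Algebra.EssFiniteType A (Localization.AtPrime q) := .comp A P.Ring _
  refine ⟨Localization.AtPrime q, inferInstance, inferInstance, inferInstance, inferInstance,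
    inferInstance, hloc, Algebra.FormallyUnramified.map_maximalIdeal,
    algebraMap P.Ring _ P.X, ?_⟩
  rw [aeval_algebraMap_apply, P.hasMap_X.1, map_zero]

/-- A flat local homomorphism is faithfully flat, so it is injective and the powers of the maximal
ideal contract back; the descent needs the latter to measure orders. -/
lemma HasRegularPair.exists_extension_root {A : Type u} [CommRing A] [IsLocalRing A]
    [IsNoetherianRing A] (h : HasRegularPair A) (f : A[X]) (hf : f.Monic) (hsep : f.Separable)
    (hdeg : f.natDegree ≠ 0) :
    ∃ (A' : Type u) (_ : CommRing A') (_ : IsLocalRing A') (_ : IsNoetherianRing A')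
      (φ : A →+* A'), HasRegularPair A' ∧ Function.Injective φ ∧
      (maximalIdeal A).map φ = maximalIdeal A' ∧
      (∀ N a, φ a ∈ maximalIdeal A' ^ N → a ∈ maximalIdeal A ^ N) ∧ ∃ x : A', f.eval₂ φ x = 0 := by
  obtain ⟨A', _, _, _, _, _, _, hmap, x, hx⟩ := exists_flat_local_extension_root f hf hsep hdeg
  have : Module.FaithfullyFlat A A' := Module.FaithfullyFlat.of_flat_of_isLocalHom
  refine ⟨A', inferInstance, inferInstance, inferInstance, algebraMap A A', h.of_flat hmap,
    FaithfulSMul.algebraMap_injective A A', hmap, fun N a ha ↦ ?_, x, hx⟩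
  rw [← hmap, ← Ideal.map_pow] at ha
  rwa [← Ideal.comap_map_eq_self_of_faithfullyFlat (B := A') (maximalIdeal A ^ N)]

/-! ### Fermat descent in dimension two -/

lemma exists_associated_pow_of_isRelPrime {A : Type*} [CommRing A] [IsDomain A]
    [UniqueFactorizationMonoid A] {a b r : A} {n : ℕ} (hab : IsRelPrime a b)
    (h : Associated (a * b) (r ^ n)) : ∃ d : A, Associated (d ^ n) a := by
  let := UniqueFactorizationMonoid.toGCDMonoid A
  obtain ⟨u, hu⟩ := h
  have hb : IsRelPrime a (b * u) := hab.mul_right (u.isUnit.isRelPrime_right)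
  exact exists_associated_pow_of_mul_eq_pow (gcd_isUnit_iff_isRelPrime.2 hb)
    (by rw [← hu, mul_assoc])

/-- The powers of `μ` sum to zero, so `n = ∑ (1 - μ ^ i)`, and `1 - μ` divides every term. -/
lemma isUnit_one_sub_of_pow_eq_one {A : Type*} [CommRing A] [IsDomain A] {n : ℕ}
    (hn : IsUnit (n : A)) {μ : A} (hμ : μ ^ n = 1) (hμ1 : μ ≠ 1) : IsUnit (1 - μ) := by
  refine isUnit_of_dvd_unit ?_ hn
  have h0 : ∑ i ∈ Finset.range n, μ ^ i = 0 := by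
    have := geom_sum_mul μ n
    rw [hμ, sub_self, mul_eq_zero] at this
    exact this.resolve_right (sub_ne_zero.2 hμ1)
  have : (n : A) = ∑ i ∈ Finset.range n, (1 - μ ^ i) := by
    rw [Finset.sum_sub_distrib, h0]; simp
  rw [this]
  refine Finset.dvd_sum fun i _ ↦ ?_
  simpa using sub_dvd_pow_sub_pow 1 μ i

lemma isUnit_sub_of_pow_eq_one {A : Type*} [CommRing A] [IsDomain A] {n : ℕ}
    (hn : IsUnit (n : A)) (hn0 : n ≠ 0) {μ ν : A} (hμ : μ ^ n = 1) (hν : ν ^ n = 1)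
    (hμν : μ ≠ ν) : IsUnit (μ - ν) := by
  have hμu : IsUnit μ := IsUnit.of_pow_eq_one hμ hn0
  obtain ⟨μ', rfl⟩ := hμu
  have : (μ' : A) - ν = μ' * (1 - (↑μ'⁻¹ : A) * ν) := by
    rw [mul_sub, ← mul_assoc]; simp
  rw [this]
  refine μ'.isUnit.mul (isUnit_one_sub_of_pow_eq_one hn ?_ ?_)
  · rw [mul_pow, hν, mul_one, ← Units.val_pow_eq_pow_val, inv_pow,
      show μ' ^ n = 1 from Units.ext (by simpa using hμ)]
    simp
  · intro h
    apply hμν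
    have := congrArg (fun z ↦ (μ' : A) * z) h
    simp only [← mul_assoc, Units.mul_inv, one_mul, mul_one] at this
    exact this.symm

/-- If `a ^ n - b ^ n` is an `n`-th power up to a unit, then so is every `a - ζ b`. -/
lemma exists_associated_pow_sub_root_mul {A : Type*} [CommRing A] [IsDomain A]
    [UniqueFactorizationMonoid A] {n : ℕ} (hn0 : n ≠ 0) (hn : IsUnit (n : A)) {ζ : A}
    (hζ : IsPrimitiveRoot ζ n) {a b r : A} (hab : IsRelPrime a b)
    (h : Associated (a ^ n - b ^ n) (r ^ n)) {μ : A} (hμ : μ ^ n = 1) :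
    ∃ d : A, Associated (d ^ n) (a - μ * b) := by
  classical
  have hpos : 0 < n := Nat.pos_of_ne_zero hn0
  rw [hζ.pow_sub_pow_eq_prod_sub_mul _ _ hpos,
    ← Finset.mul_prod_erase _ _ ((mem_nthRootsFinset hpos 1).2 hμ)] at h
  refine exists_associated_pow_of_isRelPrime (IsRelPrime.prod_right fun ν hν ↦ ?_) h
  obtain ⟨hνμ, hν⟩ := Finset.mem_erase.1 hν
  have hu := isUnit_sub_of_pow_eq_one hn hn0 ((mem_nthRootsFinset hpos 1).1 hν) hμ hνμ
  intro d hd hd'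
  refine hab ?_ ?_
  · rw [← hu.dvd_mul_left]
    have : (ν - μ) * a = ν * (a - μ * b) - μ * (a - ν * b) := by ring
    rw [this]
    exact dvd_sub (hd.mul_left _) (hd'.mul_left _)
  · rw [← hu.dvd_mul_left]
    have : (ν - μ) * b = (a - μ * b) - (a - ν * b) := by ring
    rw [this]
    exact dvd_sub hd hd'

lemma HasRegularPair.exists_extension_pow_eq {A : Type u} [CommRing A] [IsLocalRing A]
    [IsNoetherianRing A] (h : HasRegularPair A) {n : ℕ} (hn0 : n ≠ 0) (hn : IsUnit (n : A))
    (η : Aˣ) :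
    ∃ (A' : Type u) (_ : CommRing A') (_ : IsLocalRing A') (_ : IsNoetherianRing A')
      (φ : A →+* A'), HasRegularPair A' ∧ Function.Injective φ ∧
      (maximalIdeal A).map φ = maximalIdeal A' ∧
      (∀ N a, φ a ∈ maximalIdeal A' ^ N → a ∈ maximalIdeal A ^ N) ∧ ∃ x : A', x ^ n = φ η := by
  obtain ⟨A', _, _, _, φ, h1, h2, h3, h4, x, hx⟩ := h.exists_extension_root (X ^ n - C (η : A))
    (monic_X_pow_sub_C _ hn0) (separable_X_pow_sub_C_unit η hn)
    (by rw [natDegree_X_pow_sub_C]; exact hn0)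
  refine ⟨A', inferInstance, inferInstance, inferInstance, φ, h1, h2, h3, h4, x, ?_⟩
  rw [eval₂_sub, eval₂_C, eval₂_X_pow, sub_eq_zero] at hx
  exact hx

/-- Infinite descent on the order `N` of the ideal `(a, b)`. The factors `a - b`, `a - ζ b`, `a - ζ²
b` are `n`-th powers up to units and are linearly dependent. After adjoining `n`-th roots of two
units the dependence reads `P ^ n - Q ^ n = unit * p₂ ^ n`, with `(P ^ n, Q ^ n)` equal to the
extension of `(a, b)`. Thus `(P, Q)` has smaller order. A unit must be allowed in the equation for
the induction to close. -/
lemma HasRegularPair.not_associated_pow_sub_pow {n : ℕ} (hn3 : 3 ≤ n) (N : ℕ) :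
    ∀ {A : Type u} [CommRing A] [IsLocalRing A] [IsNoetherianRing A] (_ : HasRegularPair A)
      (_ : IsUnit (n : A)) {ζ : A} (_ : IsPrimitiveRoot ζ n) {a b r : A}
      (_ : a ∈ maximalIdeal A) (_ : b ∈ maximalIdeal A)
      (_ : ∃ k, maximalIdeal A ^ k ≤ Ideal.span {a, b})
      (_ : ¬ Ideal.span {a, b} ≤ maximalIdeal A ^ N), ¬ Associated (a ^ n - b ^ n) (r ^ n) := by
  induction N with
  | zero => intro A _ _ _ _ _ _ _ _ _ _ _ _ _ h; simp at h
  | succ N ih =>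
    intro A _ _ _ h hn ζ hζ a b r ha hb hk hN hr
    have hdom := h.isDomain
    have hufd := h.uniqueFactorizationMonoid
    have hab := h.isRelPrime_iff.2 hk
    by_cases hN0 : N = 0
    · subst hN0
      refine hN ?_
      rw [zero_add, pow_one, Ideal.span_le]
      rintro z (rfl | rfl) <;> assumption
    have hn0 : n ≠ 0 := by omega
    have hζ1 : ζ ^ n = 1 := hζ.pow_eq_one
    obtain ⟨p₀, ε₀, hp₀⟩ := exists_associated_pow_sub_root_mul hn0 hn hζ hab hr (one_pow n)
    obtain ⟨p₁, ε₁, hp₁⟩ := exists_associated_pow_sub_root_mul hn0 hn hζ hab hr hζ1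
    obtain ⟨p₂, ε₂, hp₂⟩ := exists_associated_pow_sub_root_mul hn0 hn hζ hab hr
      (μ := ζ ^ 2) (by rw [pow_right_comm, hζ1, one_pow])
    have hζu : IsUnit ζ := IsUnit.of_pow_eq_one hζ1 hn0
    have h1ζ : IsUnit (1 + ζ) := by
      have : IsUnit (1 - ζ ^ 2) := isUnit_one_sub_of_pow_eq_one hn
        (by rw [pow_right_comm, hζ1, one_pow]) (hζ.pow_ne_one_of_pos_of_lt (by norm_num) (by omega))
      refine isUnit_of_dvd_unit ⟨1 - ζ, by ring⟩ this
    -- The units come from `-ζ (a - b) + (1 + ζ) (a - ζ b) = a - ζ² b`: the roots of `-ζ ε₀` and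
    -- `-(1 + ζ) ε₁` turn the first term into an `n`-th power and the second into minus one. Here `n
    -- ≥ 3` ensures that `1 + ζ` is a unit.
    obtain ⟨A₁, _, _, _, φ₁, hA₁, hinj₁, hmap₁, hpow₁, ρ₀, hρ₀⟩ :=
      h.exists_extension_pow_eq hn0 hn (-(hζu.unit * ε₀))
    obtain ⟨A₂, _, _, _, φ₂, hA₂, hinj₂, hmap₂, hpow₂, ρ₁, hρ₁⟩ :=
      hA₁.exists_extension_pow_eq hn0 (by simpa using hn.map φ₁)
        (Units.map φ₁ (-(h1ζ.unit * ε₁)))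
    let φ := φ₂.comp φ₁
    have hdom₂ := hA₂.isDomain
    have hφinj : Function.Injective φ := hinj₂.comp hinj₁
    have hφmap : (maximalIdeal A).map φ = maximalIdeal A₂ := by
      rw [← Ideal.map_map, hmap₁, hmap₂]
    have hφpow : ∀ N a, φ a ∈ maximalIdeal A₂ ^ N → a ∈ maximalIdeal A ^ N :=
      fun N a ha ↦ hpow₁ N a (hpow₂ N _ ha)
    have hP : (φ₂ ρ₀ * φ p₀) ^ n = φ (-ζ * (a - b)) := by
      have : -ζ * (a - b) = (-(hζu.unit * ε₀) : Aˣ) * p₀ ^ n := by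
        rw [one_mul] at hp₀
        rw [← hp₀]; push_cast; rw [IsUnit.unit_spec]; ring
      rw [this, mul_pow, ← map_pow, hρ₀, map_mul, map_pow]; rfl
    have hQ : (ρ₁ * φ p₁) ^ n = φ (-(1 + ζ) * (a - ζ * b)) := by
      have : -(1 + ζ) * (a - ζ * b) = (-(h1ζ.unit * ε₁) : Aˣ) * p₁ ^ n := by
        rw [← hp₁]; push_cast; rw [IsUnit.unit_spec]; ring
      rw [this, mul_pow, hρ₁, map_mul, map_pow]; rfl
    have hsub : (φ₂ ρ₀ * φ p₀) ^ n - (ρ₁ * φ p₁) ^ n = φ (a - ζ ^ 2 * b) := by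
      rw [hP, hQ, ← map_sub]; congr 1; ring
    have hmem : ∀ z ∈ maximalIdeal A, φ z ∈ maximalIdeal A₂ := fun z hz ↦
      hφmap ▸ Ideal.mem_map_of_mem φ hz
    have hPm : φ₂ ρ₀ * φ p₀ ∈ maximalIdeal A₂ := by
      refine (maximalIdeal.isMaximal A₂).isPrime.mem_of_pow_mem n ?_
      rw [hP]
      exact hmem _ (Ideal.mul_mem_left _ _ (sub_mem ha hb))
    have hQm : ρ₁ * φ p₁ ∈ maximalIdeal A₂ := by
      refine (maximalIdeal.isMaximal A₂).isPrime.mem_of_pow_mem n ?_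
      rw [hQ]
      exact hmem _ (Ideal.mul_mem_left _ _ (sub_mem ha (Ideal.mul_mem_left _ _ hb)))
    -- the ideal generated by `a` and `b` is generated by the two new `n`-th powers
    have hspan : ∀ J : Ideal A₂, (φ₂ ρ₀ * φ p₀) ^ n ∈ J → (ρ₁ * φ p₁) ^ n ∈ J →
        (Ideal.span {a, b}).map φ ≤ J := by
      intro J h1 h2
      rw [hP] at h1
      rw [hQ] at h2
      have hu1 : IsUnit (φ (-ζ)) := hζu.neg.map φ
      have hu2 : IsUnit (φ (-(1 + ζ))) := h1ζ.neg.map φ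
      rw [map_mul, Ideal.unit_mul_mem_iff_mem _ hu1] at h1
      rw [map_mul, Ideal.unit_mul_mem_iff_mem _ hu2] at h2
      have hu3 : IsUnit (φ (1 - ζ)) := (isUnit_one_sub_of_pow_eq_one hn hζ1
        (hζ.ne_one (by omega))).map φ
      have hbJ : φ b ∈ J := by
        rw [← Ideal.unit_mul_mem_iff_mem _ hu3]
        have := J.sub_mem h2 h1
        rw [← map_sub] at this
        rw [← map_mul]
        convert this using 2; ring
      rw [Ideal.map_span, Ideal.span_le]
      rintro _ ⟨z, rfl | rfl, rfl⟩
      · have := J.add_mem h1 hbJ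
        rwa [← map_add, sub_add_cancel] at this
      · exact hbJ
    refine ih hA₂ (by simpa using hn.map φ) (hζ.map_of_injective hφinj) hPm hQm ?_ ?_
      (r := φ p₂) ?_
    · obtain ⟨k, hk⟩ := hk
      refine ⟨k, ?_⟩
      rw [← hφmap, ← Ideal.map_pow]
      exact (Ideal.map_mono hk).trans (hspan _
        (Ideal.pow_mem_of_mem _ (Ideal.subset_span (by simp)) _ (by omega))
        (Ideal.pow_mem_of_mem _ (Ideal.subset_span (by simp)) _ (by omega)))
    · intro hle
      -- The order rises by a factor `n` under `n`-th powers; since `N ≠ 0`, this gains at least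
      -- one.
      have hNn : N + 1 ≤ N * n := by
        have := Nat.mul_le_mul_left N hn3
        omega
      have hpw : ∀ z ∈ maximalIdeal A₂ ^ N, z ^ n ∈ maximalIdeal A₂ ^ (N + 1) := by
        intro z hz
        refine Ideal.pow_le_pow_right hNn ?_
        rw [pow_mul]
        exact Ideal.pow_mem_pow hz n
      have := hspan _ (hpw _ (hle (Ideal.subset_span (by simp))))
        (hpw _ (hle (Ideal.subset_span (by simp))))
      exact hN fun z hz ↦ hφpow _ _ (this (Ideal.mem_map_of_mem φ hz))
    · rw [hsub, ← hp₂, map_mul, map_pow]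
      exact associated_mul_unit_left _ _ (ε₂.isUnit.map φ)

/-- The Fermat equation has no solution with coprime non-units in a two-dimensional regular local
ring in which the exponent is invertible. -/
theorem HasRegularPair.pow_sub_pow_ne_pow {A : Type u} [CommRing A] [IsLocalRing A]
    [IsNoetherianRing A] (h : HasRegularPair A) {n : ℕ} (hn3 : 3 ≤ n) (hn : IsUnit (n : A))
    {a b r : A} (ha : a ∈ maximalIdeal A) (hb : b ∈ maximalIdeal A) (hab : IsRelPrime a b) :
    a ^ n - b ^ n ≠ r ^ n := by
  intro heq
  have hdom := h.isDomain
  have hsep : (cyclotomic n A).Separable := by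
    have := separable_X_pow_sub_C_unit (1 : Aˣ) hn
    rw [Units.val_one, C_1] at this
    exact this.of_dvd (cyclotomic.dvd_X_pow_sub_one n A)
  obtain ⟨A', _, _, _, φ, hA', hinj, hmap, hpow, ζ, hζ⟩ := h.exists_extension_root
    (cyclotomic n A) (cyclotomic.monic n A) hsep (by
      rw [natDegree_cyclotomic]; exact (Nat.totient_pos.2 (by omega)).ne')
  have hdom' := hA'.isDomain
  have hn' : IsUnit (n : A') := by simpa using hn.map φ
  have : NeZero (n : A') := ⟨hn'.ne_zero⟩
  have hζ' : IsPrimitiveRoot ζ n := by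
    rw [← isRoot_cyclotomic_iff, IsRoot.def, ← map_cyclotomic n φ, Polynomial.eval_map, hζ]
  have hmem : ∀ z ∈ maximalIdeal A, φ z ∈ maximalIdeal A' := fun z hz ↦
    hmap ▸ Ideal.mem_map_of_mem φ hz
  have hspan : Ideal.span {φ a, φ b} = (Ideal.span {a, b}).map φ := by
    rw [Ideal.map_span, Set.image_pair]
  obtain ⟨k, hk⟩ := h.isRelPrime_iff.1 hab
  -- Krull's intersection theorem supplies the start of the descent, because `(a, b) ≠ 0`.
  have : ∃ N, ¬ Ideal.span {φ a, φ b} ≤ maximalIdeal A' ^ N := by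
    by_contra! hcon
    have hz : ∀ z ∈ Ideal.span {φ a, φ b}, z = 0 := by
      intro z hz
      have : z ∈ (⨅ N, maximalIdeal A' ^ N : Ideal A') := by
        rw [Ideal.mem_iInf]; exact fun N ↦ hcon N hz
      rwa [Ideal.iInf_pow_eq_bot_of_isLocalRing _ (maximalIdeal.isMaximal A').ne_top] at this
    have ha0 : a = 0 := hinj (by rw [hz (φ a) (Ideal.subset_span (by simp)), map_zero])
    have hb0 : b = 0 := hinj (by rw [hz (φ b) (Ideal.subset_span (by simp)), map_zero])
    subst ha0 hb0
    exact not_isUnit_zero (hab dvd_rfl dvd_rfl)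
  obtain ⟨N, hN⟩ := this
  refine not_associated_pow_sub_pow hn3 N hA' hn' hζ' (hmem a ha) (hmem b hb) ⟨k, ?_⟩ hN
    (r := φ r) ?_
  · rw [hspan, ← hmap, ← Ideal.map_pow]
    exact Ideal.map_mono hk
  · rw [← map_pow, ← map_pow, ← map_sub, heq, map_pow]

end

/-! ### Regularity of `x` along the zero locus of `π` -/

section

open IsLocalRing

/-- The endgame: over a local factorial ring `B` of dimension at most two, a point of the two curves
`x ^ n + y ^ n = 1` and `z ^ n * (x + π) = π * (x + 1)` with `x ∉ B` forces `π` to be an `n`-th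
power up to a unit. -/
lemma exists_associated_pow_of_not_mem {B : Type u} [CommRing B] [IsDomain B] [IsLocalRing B]
    [IsNoetherianRing B] [UniqueFactorizationMonoid B]
    (hB : IsPrincipalIdealRing B ∨ HasRegularPair B) {F : Type*} [Field F]
    [Algebra B F] [IsFractionRing B F] {n : ℕ} (hn3 : 3 ≤ n) (hn : IsUnit (n : B)) {π : B}
    (hπ : π ∈ maximalIdeal B) {x y z : F} (hx : x ∉ (algebraMap B F).range)
    (hy : x ^ n + y ^ n = 1)
    (hz : z ^ n * (x + algebraMap B F π) = algebraMap B F π * (x + 1)) :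
    ∃ d ∈ maximalIdeal B, Associated π (d ^ n) := by
  obtain ⟨a, b, hab, hxab⟩ := IsFractionRing.exists_reduced_fraction B x
  have hinj := IsFractionRing.injective B F
  have hb0 : algebraMap B F b ≠ 0 := by
    simp
  have hxb : x * algebraMap B F b = algebraMap B F a := by
    rw [← hxab, IsLocalization.mk'_spec]
  have hbm : (b : B) ∈ maximalIdeal B := by
    by_contra hcon
    have hu : IsUnit (b : B) := by simpa using hcon
    refine hx ⟨a * (hu.unit⁻¹ : Bˣ), ?_⟩
    rw [map_mul, ← hxb, mul_assoc, ← map_mul, IsUnit.mul_val_inv, map_one, mul_one]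
  have hn0 : 0 < n := by omega
  have hau : IsUnit a := by
    by_contra hcon
    have ham : a ∈ maximalIdeal B := hcon
    rcases hB with hB | hB
    · obtain ⟨t, ht⟩ := hB.principal (maximalIdeal B)
      change _ = Ideal.span {t} at ht
      have htu :=
        hab (Ideal.mem_span_singleton.1 (ht ▸ ham)) (Ideal.mem_span_singleton.1 (ht ▸ hbm))
      exact (maximalIdeal.isMaximal B).ne_top (ht ▸ Ideal.span_singleton_eq_top.2 htu)
    -- Clearing denominators in the first curve: `y b` has its `n`-th power in `B`, so it lies in
    -- `B` by normality, and the Fermat theorem applies.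
    · have h1 : (y * algebraMap B F b) ^ n = algebraMap B F ((b : B) ^ n - a ^ n) := by
        rw [map_sub, map_pow, map_pow, ← hxb]
        linear_combination algebraMap B F b ^ n * hy
      obtain ⟨c, hc⟩ := IsIntegrallyClosed.exists_algebraMap_eq_of_isIntegral_pow (R := B) hn0
        (h1 ▸ isIntegral_algebraMap)
      refine hB.pow_sub_pow_ne_pow hn3 hn hbm ham hab.symm (r := c) (hinj ?_)
      rw [← h1, ← hc, map_pow]
  have hunit : ∀ c ∈ maximalIdeal B, ∀ d, IsUnit d → IsUnit (d + c) := by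
    intro c hc d hd
    by_contra hcon
    have : d + c - c ∈ maximalIdeal B := sub_mem (show d + c ∈ maximalIdeal B from hcon) hc
    rw [add_sub_cancel_right] at this
    exact this hd
  have hu₁ := hunit (π * b) (Ideal.mul_mem_right _ _ hπ) a hau
  have hu₂ := hunit b hbm a hau
  -- With `a` a unit and `b`, `π` non-units, `a + π b` and `a + b` are units, so the second curve
  -- makes `z ^ n` a unit times `π`.
  have h2 : z ^ n * algebraMap B F (a + π * b) = algebraMap B F (π * (a + b)) := by
    simp only [map_add, map_mul, ← hxb]
    linear_combination algebraMap B F b * hz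
  have h3 : z ^ n = algebraMap B F (π * (a + b) * (hu₁.unit⁻¹ : Bˣ)) := by
    rw [map_mul, ← h2, mul_assoc, ← map_mul, IsUnit.mul_val_inv, map_one, mul_one]
  obtain ⟨d, hd⟩ := IsIntegrallyClosed.exists_algebraMap_eq_of_isIntegral_pow (R := B) hn0
    (h3 ▸ isIntegral_algebraMap)
  have h4 : d ^ n = π * (a + b) * (hu₁.unit⁻¹ : Bˣ) := hinj (by rw [← h3, ← hd, map_pow])
  refine ⟨d, (maximalIdeal.isMaximal B).isPrime.mem_of_pow_mem n ?_, ?_⟩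
  · rw [h4, mul_assoc]
    exact Ideal.mul_mem_right _ _ hπ
  · rw [h4, mul_assoc]
    exact associated_mul_unit_right _ _ (hu₂.mul (Units.isUnit _))

/-- If `π` is divisible by an `n`-th power in a factorial localization of `S`, then its order at
some minimal prime is at least `n`. -/
lemma exists_mem_minimalPrimes_mul_mem_pow {S : Type u} [CommRing S] [IsDomain S] (P : Ideal S)
    [P.IsPrime] [UniqueFactorizationMonoid (Localization.AtPrime P)] {n : ℕ} {π : S} (hπ : π ≠ 0)
    {d : Localization.AtPrime P} (hdm : d ∈ maximalIdeal (Localization.AtPrime P))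
    (hd : Associated (algebraMap S _ π) (d ^ n)) (hn : n ≠ 0) :
    ∃ Q ∈ (Ideal.span {π}).minimalPrimes, ∃ s ∉ Q, s * π ∈ Q ^ n := by
  have hle : P.primeCompl ≤ nonZeroDivisors S := P.primeCompl_le_nonZeroDivisors
  have hinj : Function.Injective (algebraMap S (Localization.AtPrime P)) :=
    IsLocalization.injective (Localization.AtPrime P) hle
  have hπ0 : algebraMap S (Localization.AtPrime P) π ≠ 0 := (map_ne_zero_iff _ hinj).2 hπ
  have hd0 : d ≠ 0 := by
    rintro rfl
    rw [zero_pow hn, associated_zero_iff_eq_zero] at hd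
    exact hπ0 hd
  obtain ⟨q, hq, hqd⟩ := WfDvdMonoid.exists_irreducible_factor hdm hd0
  have hqp := hq.prime
  have hspan : (Ideal.span {q}).IsPrime := (Ideal.span_singleton_prime hqp.ne_zero).2 hqp
  -- The order of `π` is tested along the height-one prime of `S` cut out by a prime factor `q` of
  -- `d`, since `q ^ n` divides `π` in the localization.
  let Q := (Ideal.span {q}).comap (algebraMap S (Localization.AtPrime P))
  have hQ : Q.IsPrime := Ideal.comap_isPrime _ _
  have hQP : Q ≤ P := by
    intro s hs
    have : algebraMap S (Localization.AtPrime P) s ∈ maximalIdeal (Localization.AtPrime P) :=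
      (le_maximalIdeal hspan.ne_top) hs
    exact (IsLocalization.AtPrime.to_map_mem_maximal_iff (Localization.AtPrime P) P s).1 this
  have hmapQ : Q.map (algebraMap S (Localization.AtPrime P)) = Ideal.span {q} :=
    IsLocalization.map_under P.primeCompl (Localization.AtPrime P) _
  have hπQ : π ∈ Q := Ideal.mem_span_singleton.2
    ((hqd.trans (dvd_pow_self d hn)).trans hd.symm.dvd)
  have hdisj : ∀ Q' : Ideal S, Q' ≤ P → Disjoint (P.primeCompl : Set S) Q' := fun Q' h ↦
    Set.disjoint_left.2 fun s hs hs' ↦ hs (h hs')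
  refine ⟨Q, ⟨⟨hQ, (Ideal.span_singleton_le_iff_mem _).2 hπQ⟩, ?_⟩, ?_⟩
  · rintro Q' ⟨hQ', hπQ'⟩ hle'
    have hprime :=
      IsLocalization.isPrime_of_isPrime_disjoint P.primeCompl (Localization.AtPrime P) Q' hQ'
      (hdisj Q' (hle'.trans hQP))
    have hne : Q'.map (algebraMap S (Localization.AtPrime P)) ≠ ⊥ := fun h0 ↦ hπ0 (by
      have := Ideal.mem_map_of_mem (algebraMap S (Localization.AtPrime P))
        (hπQ' (Ideal.mem_span_singleton_self π))
      rwa [h0] at this)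
    -- Any nonzero prime inside `(q)` contains a prime element, which is then associated to `q`;
    -- this is the minimality of `Q`.
    obtain ⟨q', hq', hq'p⟩ := hprime.exists_mem_prime_of_ne_bot hne
    have hqq' : q ∣ q' := by
      rw [← Ideal.mem_span_singleton, ← hmapQ]
      exact Ideal.map_mono hle' hq'
    have has : Associated q q' := hqp.associated_of_dvd hq'p hqq'
    intro s hs
    have h1 : algebraMap S (Localization.AtPrime P) s ∈
        Q'.map (algebraMap S (Localization.AtPrime P)) :=
      Ideal.mem_of_dvd _ (has.symm.dvd.trans (Ideal.mem_span_singleton.1 hs)) hq'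
    rw [← IsLocalization.under_map_of_isPrime_disjoint P.primeCompl (Localization.AtPrime P) hQ'
      (hdisj Q' (hle'.trans hQP))]
    exact h1
  · have h1 : algebraMap S (Localization.AtPrime P) π ∈
        (Q ^ n).map (algebraMap S (Localization.AtPrime P)) := by
      rw [Ideal.map_pow, hmapQ]
      exact Ideal.mem_of_dvd _ hd.symm.dvd (Ideal.pow_mem_pow (Ideal.mem_span_singleton.2 hqd) n)
    rw [IsLocalization.algebraMap_mem_map_algebraMap_iff P.primeCompl
      (Localization.AtPrime P)] at h1
    obtain ⟨s, hs, hsπ⟩ := h1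
    exact ⟨s, fun h ↦ hs (hQP h), hsπ⟩

/-- Colon ideals of principal ideals are compatible with localization. -/
lemma Localization.AtPrime.mem_map_iff_of_colon {S : Type*} [CommRing S] {p P : Ideal S}
    [P.IsPrime] {b g : S}
    (hpg : ∀ r, r ∈ p ↔ r * g ∈ Ideal.span {b}) (w : Localization.AtPrime P) :
    w ∈ p.map (algebraMap S (Localization.AtPrime P)) ↔
      w * algebraMap S _ g ∈ Ideal.span {algebraMap S (Localization.AtPrime P) b} := by
  obtain ⟨r, s, rfl⟩ := IsLocalization.exists_mk'_eq P.primeCompl w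
  have h1 : IsLocalization.mk' (Localization.AtPrime P) r s * algebraMap S _ g =
      IsLocalization.mk' (Localization.AtPrime P) (r * g) s := by
    rw [mul_comm, IsLocalization.mul_mk'_eq_mk'_of_mul, mul_comm]
  have h2 : Ideal.span {algebraMap S (Localization.AtPrime P) b} =
      (Ideal.span {b}).map (algebraMap S (Localization.AtPrime P)) := by
    rw [Ideal.map_span, Set.image_singleton]
  rw [h1, h2, IsLocalization.mk'_mem_map_algebraMap_iff P.primeCompl,
    IsLocalization.mk'_mem_map_algebraMap_iff P.primeCompl]
  refine exists_congr fun t ↦ and_congr_right fun _ ↦ ?_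
  rw [hpg, mul_assoc]

/-- On a regular domain `S`, a point of the two auxiliary curves has its `x`-coordinate regular
at every point of the zero locus of `π` at which `n` is invertible. -/
theorem exists_mul_eq_of_curves {S : Type u} [CommRing S] [IsDomain S] [IsRegularRing S]
    {P₀ : Ideal S} [hP₀ : P₀.IsPrime] {π : S} (hπ0 : π ≠ 0) (hπ : π ∈ P₀) {n : ℕ} (hn3 : 3 ≤ n)
    (hn : (n : S) ∉ P₀) (hord : ∀ Q ∈ (Ideal.span {π}).minimalPrimes, ∀ s ∉ Q, s * π ∉ Q ^ n)
    {x y z : FractionRing S} (hy : x ^ n + y ^ n = 1)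
    (hz : z ^ n * (x + algebraMap S _ π) = algebraMap S _ π * (x + 1)) :
    ∃ a s, s ∉ P₀ ∧ x * algebraMap S _ s = algebraMap S _ a := by
  by_contra! hcon
  obtain ⟨c, b, hb, hxcb⟩ := IsFractionRing.div_surjective (A := S) x
  have hb0 : b ≠ 0 := nonZeroDivisors.ne_zero hb
  have hinj := IsFractionRing.injective S (FractionRing S)
  have hbF : algebraMap S (FractionRing S) b ≠ 0 := (map_ne_zero_iff _ hinj).2 hb0
  have hxb : x * algebraMap S _ b = algebraMap S _ c := by
    rw [← hxcb, div_mul_cancel₀ _ hbF]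
  have hDiff : ∀ s a, x * algebraMap S _ s = algebraMap S _ a → s * c = a * b := by
    intro s a h
    apply hinj
    rw [map_mul, map_mul, ← hxb, ← h]; ring
  -- The ideal of denominators of `x = c / b`; its zero locus is where `x` fails to be regular.
  let D : Ideal S :=
    { carrier := {s | s * c ∈ Ideal.span {b}}
      add_mem' := fun h1 h2 ↦ by
        simp only [Set.mem_ofPred_eq, add_mul] at *; exact add_mem h1 h2
      zero_mem' := by simp
      smul_mem' := fun r s hs ↦ by
        simp only [Set.mem_ofPred_eq, smul_eq_mul, mul_assoc] at *
        exact Ideal.mul_mem_left _ _ hs }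
  have hD : ∀ s, s ∈ D ↔ s * c ∈ Ideal.span {b} := fun s ↦ Iff.rfl
  have hDx : ∀ s ∈ D, ∃ a, x * algebraMap S _ s = algebraMap S _ a := by
    intro s hs
    obtain ⟨a, ha⟩ := Ideal.mem_span_singleton'.1 ((hD s).1 hs)
    refine ⟨a, mul_right_cancel₀ hbF ?_⟩
    rw [← map_mul, ha, map_mul, ← hxb]; ring
  have hDP : D ≤ P₀ := by
    intro s hs
    by_contra hsP
    obtain ⟨a, ha⟩ := hDx s hs
    exact hcon a s hsP ha
  obtain ⟨p, hpmin, hpP₀⟩ := Ideal.exists_minimalPrimes_le hDP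
  have hp := hpmin.1.1
  -- A minimal prime over `D = ann (S / D)` is associated to `S / D`, and multiplication by `c`
  -- embeds `S / D` into `S / (b)`.
  obtain ⟨g, hpg⟩ : ∃ g, ∀ r, r ∈ p ↔ r * g ∈ Ideal.span {b} := by
    have h1 : p ∈ associatedPrimes S (S ⧸ D) :=
      Module.associatedPrimes.minimalPrimes_annihilator_subset_associatedPrimes S (S ⧸ D)
        (by rwa [Ideal.annihilator_quotient])
    obtain ⟨-, g', hg'⟩ := isAssociatedPrime_iff.1 h1
    obtain ⟨g, rfl⟩ := Ideal.Quotient.mk_surjective g'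
    refine ⟨g * c, fun r ↦ ?_⟩
    rw [hg', Submodule.mem_colon_singleton, Submodule.mem_bot, Algebra.smul_def,
      Ideal.Quotient.algebraMap_eq, ← map_mul, Ideal.Quotient.eq_zero_iff_mem, hD, mul_assoc]
  -- it suffices to find a point of dimension at most two with the required properties
  have key : ∀ (P : Ideal S) [P.IsPrime], p ≤ P → P ≤ P₀ → π ∈ P →
      (IsPrincipalIdealRing (Localization.AtPrime P) ∨ HasRegularPair (Localization.AtPrime P)) →
      False := by
    intro P _ hpP hPP₀ hπP hB
    have hufd : UniqueFactorizationMonoid (Localization.AtPrime P) := by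
      rcases hB with hB | hB
      · infer_instance
      · exact hB.uniqueFactorizationMonoid
    have hscal : ∀ s, algebraMap (Localization.AtPrime P) (FractionRing S) (algebraMap S _ s) =
        algebraMap S _ s := fun s ↦ (IsScalarTower.algebraMap_apply S _ _ s).symm
    obtain ⟨d, hd, hass⟩ := exists_associated_pow_of_not_mem hB (F := FractionRing S) hn3
      (π := algebraMap S _ π) (x := x) (y := y) (z := z)
      (by
        rw [← map_natCast (algebraMap S (Localization.AtPrime P))]
        exact (IsLocalization.AtPrime.isUnit_to_map_iff _ P _).2 fun h ↦ hn (hPP₀ h))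
      ((IsLocalization.AtPrime.to_map_mem_maximal_iff _ P _).2 hπP)
      (by
        rintro ⟨w, hw⟩
        obtain ⟨a, s, rfl⟩ := IsLocalization.exists_mk'_eq P.primeCompl w
        have h1 : x * algebraMap S _ (s : S) = algebraMap S _ a := by
          rw [← hw, ← hscal, ← hscal, ← map_mul, IsLocalization.mk'_spec]
        have h2 : (s : S) ∈ D := (hD s).2 (hDiff _ _ h1 ▸
          Ideal.mul_mem_left _ _ (Ideal.mem_span_singleton_self b))
        exact s.2 (hpP (hpmin.1.2 h2)))
      hy (by rw [hscal, hz])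
    obtain ⟨Q, hQ, s, hs, hsπ⟩ := exists_mem_minimalPrimes_mul_mem_pow P hπ0 hd hass (by omega)
    exact hord Q hQ s hs hsπ
  have hbB : ∀ (P : Ideal S) [P.IsPrime], algebraMap S (Localization.AtPrime P) b ≠ 0 := fun P _ ↦
    (map_ne_zero_iff _ (IsLocalization.injective _ P.primeCompl_le_nonZeroDivisors)).2 hb0
  by_cases hπp : π ∈ p
  -- At `p` itself, `g` is a socle element modulo `b`, so `S_p` has depth at most one and therefore
  -- dimension at most one.
  · refine key p le_rfl hpP₀ hπp (Or.inl ?_)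
    refine IsRegularLocalRing.isPrincipalIdealRing_of_le_one ?_
    by_contra! hrank
    refine IsRegularLocalRing.not_hasSocle_span_singleton hrank (hbB p) ⟨algebraMap S _ g, ?_, ?_⟩
    · have := Localization.AtPrime.mem_map_iff_of_colon (P := p) hpg 1
      rw [one_mul, Localization.AtPrime.map_eq_maximalIdeal] at this
      rw [← this, ← Ideal.eq_top_iff_one]
      exact (maximalIdeal.isMaximal _).ne_top
    · intro r hr
      rwa [← Localization.AtPrime.mem_map_iff_of_colon hpg,
        Localization.AtPrime.map_eq_maximalIdeal]
  -- When `π ∉ p`, move to a component of the locus where `π` vanishes on the zero set of `p`. By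
  -- Krull's principal ideal theorem `P / p` has height at most one, so no prime lies strictly
  -- between; dimension at least three would produce one.
  obtain ⟨P, hPmin, hPP₀⟩ := Ideal.exists_minimalPrimes_le (I := p ⊔ Ideal.span {π}) (J := P₀)
    (sup_le hpP₀ ((Ideal.span_singleton_le_iff_mem _).2 hπ))
  have hP := hPmin.1.1
  have hpP : p ≤ P := le_sup_left.trans hPmin.1.2
  have hπP : π ∈ P := hPmin.1.2 (Submodule.mem_sup_right (Ideal.mem_span_singleton_self π))
  refine key P hpP hPP₀ hπP ?_
  have hdisj : Disjoint (P.primeCompl : Set S) p := Set.disjoint_left.2 fun s hs hs' ↦ hs (hpP hs')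
  have hpB := IsLocalization.isPrime_of_isPrime_disjoint P.primeCompl (Localization.AtPrime P) p hp
    hdisj
  have hrank : (maximalIdeal (Localization.AtPrime P)).spanFinrank ≤ 2 := by
    by_contra! hrank
    obtain ⟨q, hq, hpq, hqm⟩ := IsRegularLocalRing.exists_prime_between hrank (hbB P) hpB
      (Localization.AtPrime.mem_map_iff_of_colon hpg)
    have hQ : (q.comap (algebraMap S (Localization.AtPrime P))).IsPrime := Ideal.comap_isPrime _ _
    set Q := q.comap (algebraMap S (Localization.AtPrime P)) with hQdef
    have hQmap : Q.map (algebraMap S (Localization.AtPrime P)) = q :=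
      IsLocalization.map_under P.primeCompl _ _
    have hpQ : p < Q := by
      refine lt_of_le_of_ne (Ideal.map_le_iff_le_comap.1 hpq.le) fun h ↦ hpq.ne ?_
      rw [h, hQmap]
    have hQP : Q < P := by
      refine lt_of_le_of_ne (fun s hs ↦ ?_) fun h ↦ hqm.ne ?_
      · exact (IsLocalization.AtPrime.to_map_mem_maximal_iff _ P s).1 (hqm.le hs)
      · rw [← hQmap, h, Localization.AtPrime.map_eq_maximalIdeal]
    have hht := Ideal.map_height_le_one_of_mem_minimalPrimes hPmin
    have hQ' := Ideal.isPrime_map_quotientMk_of_isPrime hpQ.le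
    have hP' := Ideal.isPrime_map_quotientMk_of_isPrime hpP
    have hlt : Q.map (Ideal.Quotient.mk p) < P.map (Ideal.Quotient.mk p) := by
      refine lt_of_le_of_ne (Ideal.map_mono hQP.le) fun h ↦ hQP.not_ge fun s hs ↦ ?_
      have := Ideal.mem_map_of_mem (Ideal.Quotient.mk p) hs
      rwa [← h, Ideal.mem_quotient_iff_mem hpQ.le] at this
    have h1 := (Ideal.height_add_one_le_of_lt_of_isPrime hlt).trans hht
    have h2 : (Q.map (Ideal.Quotient.mk p)).height = 0 := by
      by_contra hne
      have h3 : (1 : ℕ∞) + 1 ≤ 1 :=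
        (add_le_add_left (Order.one_le_iff_ne_zero.2 hne) 1).trans h1
      exact absurd h3 (by norm_num)
    rw [Ideal.height_eq_zero_iff_eq_bot] at h2
    refine hpQ.not_ge fun s hs ↦ ?_
    rw [← Ideal.Quotient.eq_zero_iff_mem, ← Ideal.mem_bot, ← h2]
    exact Ideal.mem_map_of_mem _ hs
  rcases hrank.lt_or_eq with h | h
  · exact Or.inl (IsRegularLocalRing.isPrincipalIdealRing_of_le_one (by omega))
  · right
    have hdom := IsRegularLocalRing.isDomain (Localization.AtPrime P)
    obtain ⟨s, -, t, -, hs, ht, hm, -⟩ :=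
      IsRegularLocalRing.exists_regular_pair (Localization.AtPrime P) h.ge
    exact ⟨s, t, hm h, fun r hr ↦ by simpa [hs] using hr, ht⟩

end

/-! ### Étale open sets defined by `n`-th powers, and reduction to neighbourhoods of `0` -/

section

namespace EtaleOpen

open Limits Polynomial
open scoped Topology

variable {K : Type u} [Field K]

/-- The standard étale algebra `K[t][T, T⁻¹] / (T ^ n - t)` over `K[t]`. -/
noncomputable def rootPair (n : ℕ) (hn : (n : K) ≠ 0) : StandardEtalePair K[X] where
  f := X ^ n - C X
  monic_f := monic_X_pow_sub_C _ (by rintro rfl; simp at hn)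
  g := X
  -- The derivative is `n T ^ (n - 1)`, so multiplying by `1 / n` gives the power `n - 1` of the
  -- inverted element `T`.
  cond := ⟨C (C (n : K)⁻¹), 0, n - 1, by
    rw [derivative_sub, derivative_X_pow, derivative_C]
    have : (n : K[X][X]) = C (C (n : K)) := by simp
    simp only [mul_zero, add_zero, sub_zero, map_natCast]
    rw [this, mul_right_comm, ← C_mul, ← C_mul, mul_inv_cancel₀ hn]; simp⟩

/-- The morphism of schemes defining the étale cover of the affine line by `t = T ^ n`. -/
noncomputable def rootCover (n : ℕ) (hn : (n : K) ≠ 0) :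
    Spec (CommRingCat.of (rootPair n hn).Ring) ⟶ Spec (CommRingCat.of K[X]) :=
  Spec.map (CommRingCat.ofHom (algebraMap K[X] (rootPair n hn).Ring))

instance (n : ℕ) (hn : (n : K) ≠ 0) : Etale (rootCover n hn) := by
  unfold rootCover
  rw [HasRingHomProperty.Spec_iff (P := @Etale)]
  simp only [CommRingCat.hom_ofHom]
  rw [RingHom.etale_algebraMap]
  infer_instance

/-- The inclusion of the constants into the global functions. -/
noncomputable def constants (V : Over (Spec (CommRingCat.of K))) : K →+* Γ(V.left, ⊤) :=
  ((Scheme.ΓSpecIso (CommRingCat.of K)).inv ≫ V.hom.appTop).hom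

/-- Evaluation of global functions at a point, as a ring homomorphism. -/
noncomputable def Points.evalHom {V : Over (Spec (CommRingCat.of K))} (p : Points V) :
    Γ(V.left, ⊤) →+* K :=
  (p.left.appTop ≫ (Scheme.ΓSpecIso (CommRingCat.of K)).hom).hom

lemma Points.evalHom_apply {V : Over (Spec (CommRingCat.of K))} (p : Points V)
    (s : Γ(V.left, ⊤)) : p.evalHom s = Points.eval s p := rfl

lemma Points.left_comp_hom {V : Over (Spec (CommRingCat.of K))} (p : Points V) :
    p.left ≫ V.hom = 𝟙 _ := Over.w p

lemma Points.evalHom_comp_constants {V : Over (Spec (CommRingCat.of K))} (p : Points V) :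
    p.evalHom.comp (constants V) = RingHom.id K := by
  have h : ((Scheme.ΓSpecIso (CommRingCat.of K)).inv ≫ V.hom.appTop) ≫
      (p.left.appTop ≫ (Scheme.ΓSpecIso (CommRingCat.of K)).hom) = 𝟙 _ := by
    have h1 : V.hom.appTop ≫ p.left.appTop = 𝟙 _ := by
      rw [← Scheme.Hom.comp_appTop, p.left_comp_hom]; rfl
    rw [Category.assoc, reassoc_of% h1, Iso.inv_hom_id]
  exact congrArg CommRingCat.Hom.hom h

lemma Points.eval_constants {V : Over (Spec (CommRingCat.of K))} (p : Points V) (a : K) :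
    Points.eval (constants V a) p = a :=
  congrArg (fun f : K →+* K ↦ f a) p.evalHom_comp_constants

lemma Points.eval_eval₂ {V : Over (Spec (CommRingCat.of K))} (p : Points V) (s : Γ(V.left, ⊤))
    (h : K[X]) :
    Points.eval (h.eval₂ (constants V) s) p = h.eval (Points.eval s p) := by
  rw [← Points.evalHom_apply, hom_eval₂, p.evalHom_comp_constants, Points.evalHom_apply, eval₂_id]

/-- The morphism to the affine line given by a global function. -/
noncomputable def toLine (V : Over (Spec (CommRingCat.of K))) (s : Γ(V.left, ⊤)) :
    V.left ⟶ Spec (CommRingCat.of K[X]) :=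
  V.left.toSpecΓ ≫ Spec.map (CommRingCat.ofHom (eval₂RingHom (constants V) s))

lemma Points.left_comp_toLine {V : Over (Spec (CommRingCat.of K))} (p : Points V)
    (s : Γ(V.left, ⊤)) :
    p.left ≫ toLine V s = Spec.map (CommRingCat.ofHom (evalRingHom (Points.eval s p))) := by
  have h : CommRingCat.ofHom (evalRingHom (Points.eval s p)) =
      CommRingCat.ofHom (eval₂RingHom (constants V) s) ≫ p.left.appTop ≫
        (Scheme.ΓSpecIso (CommRingCat.of K)).hom := by
    refine CommRingCat.hom_ext (RingHom.ext fun h ↦ ?_)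
    change h.eval (Points.eval s p) = Points.eval (h.eval₂ (constants V) s) p
    rw [Points.eval_eval₂]
  rw [toLine, h, Spec.map_comp, Spec.map_comp, ← Category.assoc]
  congr 1
  rw [Scheme.toSpecΓ_naturality, SpecMap_ΓSpecIso_hom]
  rfl

/-- The locus where a function is a nonzero `n`-th power is an étale image. -/
lemma isEtaleImage_setOf_eval_pow (V : Over (Spec (CommRingCat.of K))) (hV : IsVariety V)
    (s : Γ(V.left, ⊤)) (n : ℕ) (hn : (n : K) ≠ 0) :
    IsEtaleImage V {p | Points.eval s p ≠ 0 ∧ ∃ y, y ^ n = Points.eval s p} := by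
  -- Base change of the cover `t = T ^ n`, `T` invertible, along `s`: a `K`-point of `W` is a point
  -- of `V` with a nonzero `n`-th root of the value of `s`.
  let W : Over (Spec (CommRingCat.of K)) :=
    Over.mk (pullback.fst (toLine V s) (rootCover n hn) ≫ V.hom)
  let f : W ⟶ V := Over.homMk (pullback.fst (toLine V s) (rootCover n hn))
  have := hV.isSeparated
  have := hV.locallyOfFiniteType
  have := hV.quasiCompact
  have hsep : IsSeparated (rootCover n hn) := by unfold rootCover; infer_instance
  have hqc : QuasiCompact (rootCover n hn) := by unfold rootCover; infer_instance
  refine ⟨W, f, ⟨?_, ?_, ?_⟩, ?_, ?_⟩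
  · change IsSeparated (_ ≫ _); infer_instance
  · change LocallyOfFiniteType (_ ≫ _); infer_instance
  · change QuasiCompact (_ ≫ _); infer_instance
  · change Etale (pullback.fst _ _); infer_instance
  · ext p
    constructor
    · rintro ⟨h0, y, hy⟩
      let := (evalRingHom (Points.eval s p)).toAlgebra
      have halg : algebraMap K[X] K = evalRingHom (Points.eval s p) := rfl
      have hy0 : y ≠ 0 := by
        rintro rfl
        rw [zero_pow (by rintro rfl; simp at hn)] at hy
        exact h0 hy.symm
      have hmap : (rootPair n hn).HasMap y := by
        constructor
        · simp [rootPair, halg, hy]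
        · simpa [rootPair] using hy0
      let ψ : (rootPair n hn).Ring →+* K := ((rootPair n hn).lift y hmap).toRingHom
      have hψ : ψ.comp (algebraMap _ _) = evalRingHom (Points.eval s p) :=
        ((rootPair n hn).lift y hmap).comp_algebraMap
      have hcomp : p.left ≫ toLine V s =
          Spec.map (CommRingCat.ofHom ψ) ≫ rootCover n hn := by
        rw [p.left_comp_toLine, rootCover, ← Spec.map_comp, ← CommRingCat.ofHom_comp, hψ]
      refine ⟨Over.homMk (pullback.lift p.left (Spec.map (CommRingCat.ofHom ψ)) hcomp) ?_, ?_⟩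
      · change pullback.lift _ _ _ ≫ pullback.fst _ _ ≫ V.hom = _
        rw [pullback.lift_fst_assoc]
        exact Over.w p
      · ext1
        exact pullback.lift_fst _ _ _
    · rintro ⟨q, rfl⟩
      obtain ⟨ψ, hψ⟩ := Spec.map_surjective (q.left ≫ pullback.snd (toLine V s) (rootCover n hn))
      have h1 : (Points.map f q).left ≫ toLine V s = Spec.map ψ ≫ rootCover n hn := by
        change (q.left ≫ pullback.fst _ _) ≫ _ = _
        rw [hψ, Category.assoc, Category.assoc, pullback.condition]
      rw [Points.left_comp_toLine, rootCover, ← Spec.map_comp] at h1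
      have h2 := congrArg CommRingCat.Hom.hom (Spec.map_injective h1)
      have h3 : ∀ a : K[X], ψ.hom (algebraMap _ _ a) = a.eval (Points.eval s (Points.map f q)) :=
        fun a ↦ (congrArg (fun g : K[X] →+* K ↦ g a) h2).symm
      have hX := (rootPair n hn).hasMap_X
      have hpow : ψ.hom (rootPair n hn).X ^ n = Points.eval s (Points.map f q) := by
        have h4 : (rootPair n hn).X ^ n = algebraMap K[X] _ X := by
          have h5 : aeval (rootPair n hn).X (X ^ n - C X : K[X][X]) = 0 := hX.1
          rwa [map_sub, map_pow, aeval_X, aeval_C, sub_eq_zero] at h5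
        rw [← map_pow, h4, h3, eval_X]
      refine ⟨?_, _, hpow⟩
      have hu : IsUnit (rootPair n hn).X := by
        have h5 : IsUnit (aeval (rootPair n hn).X (X : K[X][X])) := hX.2
        rwa [aeval_X] at h5
      rw [← hpow]
      exact pow_ne_zero _ (hu.map ψ.hom).ne_zero

lemma isEtaleImage_univ (V : Over (Spec (CommRingCat.of K))) (hV : IsVariety V) :
    IsEtaleImage V Set.univ := by
  refine ⟨V, 𝟙 V, hV, ?_, ?_⟩
  · change Etale (𝟙 V.left); infer_instance
  · refine (Set.range_eq_univ.2 fun p ↦ ⟨p, Category.comp_id p⟩).symm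

/-- If the fraction field `K` of `R` has finitely many étale conditions which hold at `0` and force
an element to lie in `R`, then regular functions are continuous from the étale open topology to the
`R`-adic topology. -/
lemma etaleOpenTopology_le_affinePointsTopology {R : Type u} [CommRing R] [Algebra R K]
    {n : ℕ} (hn : (n : K) ≠ 0) (T : Finset K[X])
    (h0 : ∀ h ∈ T, h.eval 0 ≠ 0 ∧ ∃ y, y ^ n = h.eval 0)
    (hT : ∀ x : K, (∀ h ∈ T, h.eval x ≠ 0 ∧ ∃ y, y ^ n = h.eval x) → x ∈ (algebraMap R K).range)
    (V : Over (Spec (CommRingCat.of K))) (hV : IsVariety V) :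
    etaleOpenTopology V ≤ affinePointsTopology (adicTopology R K) V := by
  refine le_iInf fun s ↦ ?_
  rw [← continuous_iff_le_induced]
  refine continuous_generateFrom_iff.2 ?_
  rintro _ ⟨a, b, ha, rfl⟩
  let _ := etaleOpenTopology V
  rw [isOpen_iff_forall_mem_open]
  rintro p ⟨r, hr⟩
  -- Normalize `s` so that `p` goes to `0` and `a R` becomes `R`. If `s'` takes a value in `R` at
  -- `q`, then `s` at `q` differs from its value at `p` by an element of `a R`, so it stays in `a R
  -- + b`.
  let s' := constants V a⁻¹ * (s - constants V (Points.eval s p))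
  have hs' : ∀ q : Points V, Points.eval s' q = a⁻¹ * (Points.eval s q - Points.eval s p) := by
    intro q
    rw [← Points.evalHom_apply, map_mul, map_sub, Points.evalHom_apply, Points.evalHom_apply,
      Points.evalHom_apply, Points.eval_constants, Points.eval_constants]
  refine ⟨⋂ h ∈ T, {q | Points.eval (h.eval₂ (constants V) s') q ≠ 0 ∧
    ∃ y, y ^ n = Points.eval (h.eval₂ (constants V) s') q}, ?_, ?_, ?_⟩
  · intro q hq
    simp only [Set.mem_iInter, Set.mem_ofPred_eq, Points.eval_eval₂] at hq
    obtain ⟨r', hr'⟩ := hT _ hq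
    refine ⟨r' + r, ?_⟩
    change a * algebraMap R K r + b = _ at hr
    rw [hs'] at hr'
    simp only [map_add, mul_add, hr', add_assoc]
    rw [hr, mul_inv_cancel_left₀ ha, sub_add_cancel]
  · exact isOpen_biInter_finset fun h _ ↦ TopologicalSpace.isOpen_generateFrom_of_mem
      (isEtaleImage_setOf_eval_pow V hV _ n hn)
  · simp only [Set.mem_iInter, Set.mem_ofPred_eq, Points.eval_eval₂, hs', sub_self, mul_zero]
    exact h0

lemma IsVariety.openSubscheme {V : Over (Spec (CommRingCat.of K))} (hV : IsVariety V)
    {U : V.left.Opens} (hU : IsAffineOpen U) : IsVariety (openSubscheme V U) := by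
  have := hV.isSeparated
  have := hV.locallyOfFiniteType
  have : IsAffine U.toScheme := hU
  refine ⟨?_, ?_, ?_⟩
  · change IsSeparated (U.ι ≫ V.hom); infer_instance
  · change LocallyOfFiniteType (U.ι ≫ V.hom); infer_instance
  · change QuasiCompact (U.ι ≫ V.hom)
    rw [quasiCompact_iff_compactSpace]; infer_instance

lemma Points.map_openSubschemeι_injective {V : Over (Spec (CommRingCat.of K))}
    (U : V.left.Opens) : Function.Injective (Points.map (openSubschemeι V U)) := by
  intro p q h
  have h1 : p.left ≫ U.ι = q.left ≫ U.ι := congrArg (fun f : Points V ↦ f.left) h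
  ext1
  exact (cancel_mono U.ι).1 h1

/-- An étale map followed by an open immersion is étale, so basic open sets go to basic open sets.
Injectivity on points lets images commute with intersections. -/
lemma isOpen_image_openSubscheme {V : Over (Spec (CommRingCat.of K))} (hV : IsVariety V)
    {U : V.left.Opens} (hU : IsAffineOpen U) {S : Set (Points (openSubscheme V U))}
    (hS : IsOpen[etaleOpenTopology (openSubscheme V U)] S) :
    IsOpen[etaleOpenTopology V] (Points.map (openSubschemeι V U) '' S) := by
  have hbasic : ∀ S, IsEtaleImage (openSubscheme V U) S →
      IsEtaleImage V (Points.map (openSubschemeι V U) '' S) := by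
    rintro _ ⟨W, f, hW, hf, rfl⟩
    refine ⟨W, f ≫ openSubschemeι V U, hW, ?_, ?_⟩
    · have hf' : Etale (Y := U.toScheme) f.left := hf
      exact inferInstanceAs (Etale ((show W.left ⟶ U.toScheme from f.left) ≫ U.ι))
    · rw [← Set.range_comp]
      congr 1
  let _ := etaleOpenTopology V
  replace hS : TopologicalSpace.GenerateOpen _ S := hS
  induction hS with
  | basic S hS => exact TopologicalSpace.isOpen_generateFrom_of_mem (hbasic S hS)
  | univ =>
    exact TopologicalSpace.isOpen_generateFrom_of_mem
      (hbasic _ (isEtaleImage_univ _ (hV.openSubscheme hU)))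
  | inter S T _ _ hS hT =>
    rw [Set.image_inter (Points.map_openSubschemeι_injective U)]
    exact hS.inter hT
  | sUnion S _ hS =>
    rw [Set.sUnion_eq_biUnion, Set.image_iUnion₂]
    exact isOpen_biUnion hS

lemma Points.exists_map_openSubschemeι_eq {V : Over (Spec (CommRingCat.of K))} (p : Points V) :
    ∃ U : V.left.affineOpens, ∃ q, Points.map (openSubschemeι V U) q = p := by
  obtain ⟨U, hU, hxU, -⟩ := exists_isAffineOpen_mem_and_subset (X := V.left)
    (x := p.left (IsLocalRing.closedPoint K)) (U := ⊤) trivial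
  have hι : IsOpenImmersion (Scheme.Opens.ι U) := inferInstance
  have hrange : Set.range p.left ⊆ Set.range (Scheme.Opens.ι U) := by
    rintro _ ⟨x, rfl⟩
    rw [Scheme.Opens.range_ι]
    have : x = IsLocalRing.closedPoint K := Subsingleton.elim (α := PrimeSpectrum K) _ _
    rw [this]; exact hxU
  let l : Spec (CommRingCat.of K) ⟶ U.toScheme :=
    IsOpenImmersion.lift (Scheme.Opens.ι U) p.left hrange
  have hl : l ≫ Scheme.Opens.ι U = p.left := IsOpenImmersion.lift_fac _ _ _
  refine ⟨⟨U, hU⟩, Over.homMk l ?_, ?_⟩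
  · change l ≫ Scheme.Opens.ι U ≫ V.hom = _
    rw [reassoc_of% hl]
    exact Over.w p
  · ext1
    exact hl

/-- If regular functions on affine varieties are continuous, then the étale open topology
refines the topology glued from the affine pieces. -/
lemma etaleOpenTopology_le_pointsTopology {τ : TopologicalSpace K}
    (h : ∀ V : Over (Spec (CommRingCat.of K)), IsVariety V →
      etaleOpenTopology V ≤ affinePointsTopology τ V)
    (V : Over (Spec (CommRingCat.of K))) (hV : IsVariety V) :
    etaleOpenTopology V ≤ pointsTopology τ V := by
  intro S hS
  rw [isOpen_iSup_iff] at hS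
  have hSU : S = ⋃ U : V.left.affineOpens, Points.map (openSubschemeι V U) ''
      (Points.map (openSubschemeι V U) ⁻¹' S) := by
    ext p
    simp only [Set.mem_iUnion]
    constructor
    · intro hp
      obtain ⟨U, q, rfl⟩ := p.exists_map_openSubschemeι_eq
      exact ⟨U, q, hp, rfl⟩
    · rintro ⟨U, q, hq, rfl⟩
      exact hq
  let _ := etaleOpenTopology V
  rw [hSU]
  exact isOpen_iUnion fun U ↦ isOpen_image_openSubscheme hV U.2
    (h _ (hV.openSubscheme U.2) _ (isOpen_coinduced.1 (hS U)))

end EtaleOpen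

end

/-! ### Orders of vanishing, dominating valuation rings and affine charts -/

section AlteredLocalUniformization

open IsLocalRing

/-- In a Noetherian domain, the vanishing order of a nonzero element along the components of its
divisor is bounded. -/
lemma exists_forall_mul_notMem_pow {S : Type*} [CommRing S] [IsDomain S] [IsNoetherianRing S]
    {π : S} (hπ : π ≠ 0) :
    ∃ N, ∀ n, N ≤ n → ∀ Q ∈ (Ideal.span {π}).minimalPrimes, ∀ s ∉ Q, s * π ∉ Q ^ n := by
  have key : ∀ Q ∈ (Ideal.span {π}).minimalPrimes, ∃ N, ∀ s ∉ Q, s * π ∉ Q ^ N := by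
    intro Q hQ
    have := hQ.1.1
    by_contra! h
    -- Unbounded order along `Q` would put `π` in every power of the maximal ideal of `S_Q`, against
    -- Krull's intersection theorem.
    have hinj := IsLocalization.injective (Localization.AtPrime Q) Q.primeCompl_le_nonZeroDivisors
    refine hπ (hinj ?_)
    rw [map_zero, ← Ideal.mem_bot,
      ← Ideal.iInf_pow_eq_bot_of_isLocalRing _ (maximalIdeal.isMaximal _).ne_top, Ideal.mem_iInf]
    intro N
    obtain ⟨s, hs, hsN⟩ := h N
    have hu : IsUnit (algebraMap S (Localization.AtPrime Q) s) :=
      IsLocalization.map_units _ (⟨s, hs⟩ : Q.primeCompl)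
    rw [← Ideal.unit_mul_mem_iff_mem _ hu, ← map_mul, ← Localization.AtPrime.map_eq_maximalIdeal,
      ← Ideal.map_pow]
    exact Ideal.mem_map_of_mem _ hsN
  choose! f hf using key
  have hfin := Ideal.finite_minimalPrimes_of_isNoetherianRing S (Ideal.span {π})
  obtain ⟨N, hN⟩ := (hfin.image f).bddAbove
  exact ⟨N, fun n hn Q hQ s hs h ↦ hf Q hQ s hs
    (Ideal.pow_le_pow_right ((hN ⟨Q, hQ, rfl⟩).trans hn) h)⟩

/-- An element of the fraction field outside an integrally closed local domain lies outside a
valuation ring dominating it. -/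
lemma exists_valuationSubring_of_notMem_range {R K : Type*} [CommRing R] [IsDomain R]
    [IsIntegrallyClosed R] [IsLocalRing R] [Field K] [Algebra R K] [IsFractionRing R K] {x : K}
    (hx : x ∉ (algebraMap R K).range) :
    ∃ (O : ValuationSubring K) (h : ∀ r : R, algebraMap R K r ∈ O),
      IsLocalHom ((algebraMap R K).codRestrict O.toSubring h) ∧ x ∉ O := by
  have : IsIntegrallyClosedIn (LocalSubring.range (algebraMap R K)).toSubring K := by
    change IsIntegrallyClosedIn (algebraMap R K).range K
    rw [isIntegrallyClosedIn_iff]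
    refine ⟨Subtype.val_injective, fun {y} hy ↦ ?_⟩
    let : Algebra R (algebraMap R K).range := (algebraMap R K).rangeRestrict.toAlgebra
    have : IsScalarTower R (algebraMap R K).range K := .of_algebraMap_eq fun _ ↦ rfl
    have : Algebra.IsIntegral R (algebraMap R K).range :=
      Algebra.isIntegral_of_surjective (algebraMap R K).rangeRestrict_surjective
    have hy' : IsIntegral R y := isIntegral_trans y hy
    obtain ⟨r, rfl⟩ := IsIntegrallyClosed.isIntegral_iff.1 hy'
    exact ⟨⟨_, r, rfl⟩, rfl⟩
  obtain ⟨O, hO, hxO⟩ := LocalSubring.exists_le_valuationSubring_of_isIntegrallyClosedIn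
    (R := LocalSubring.range (algebraMap R K)) hx
  refine ⟨O, fun r ↦ hO.1 ⟨r, rfl⟩, ?_, hxO⟩
  exact @RingHom.isLocalHom_comp _ _ _ _ _ _ _ _ hO.2
    (.of_surjective _ (algebraMap R K).rangeRestrict_surjective)

namespace EtaleOpen

lemma IsRegularScheme.isRegularRing {X : Scheme.{u}} (hX : IsRegularScheme X) {U : X.Opens}
    (hU : IsAffineOpen U) : IsRegularRing Γ(X, U) := by
  have := hX.isLocallyNoetherian
  have : IsNoetherianRing Γ(X, U) := IsLocallyNoetherian.component_noetherian ⟨U, hU⟩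
  rw [isRegularRing_iff]
  intro p hp
  have hy : hU.fromSpec ⟨p, hp⟩ ∈ U := by
    have : hU.fromSpec ⟨p, hp⟩ ∈ Set.range hU.fromSpec := ⟨_, rfl⟩
    rwa [hU.range_fromSpec] at this
  have := hX.isRegularLocalRing_stalk (hU.fromSpec ⟨p, hp⟩)
  let := TopCat.Presheaf.algebra_section_stalk X.presheaf ⟨hU.fromSpec ⟨p, hp⟩, hy⟩
  have : IsLocalization p.primeCompl (X.presheaf.stalk (hU.fromSpec ⟨p, hp⟩)) :=
    hU.isLocalization_stalk' ⟨p, hp⟩ hy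
  exact IsRegularLocalRing.of_ringEquiv (IsLocalization.algEquiv p.primeCompl
    (X.presheaf.stalk (hU.fromSpec ⟨p, hp⟩)) (Localization.AtPrime p)).toRingEquiv

/-- A local ring centred in an affine chart factors through its ring of functions. -/
lemma exists_ringHom_of_mem {R O' : Type u} [CommRing R] [CommRing O'] [IsLocalRing O']
    {X : Scheme.{u}} {f : X ⟶ Spec (CommRingCat.of R)} {g : Spec (CommRingCat.of O') ⟶ X}
    {θ : R →+* O'} (hg : g ≫ f = Spec.map (CommRingCat.ofHom θ))
    {U : X.Opens} (hU : IsAffineOpen U) (hgU : g (closedPoint O') ∈ U)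
    {ρ : R →+* Γ(X, U)} (hρ : Spec.map (CommRingCat.ofHom ρ) = hU.fromSpec ≫ f) :
    ∃ ψ : Γ(X, U) →+* O', ψ.comp ρ = θ := by
  have htop : g ⁻¹ᵁ U = ⊤ := IsLocalRing.closed_point_mem_iff.1 hgU
  have hrange : Set.range g ⊆ Set.range hU.fromSpec := by
    rintro _ ⟨x, rfl⟩
    rw [hU.range_fromSpec]
    change x ∈ g ⁻¹ᵁ U
    rw [htop]; trivial
  obtain ⟨ψ, hψ⟩ := Spec.map_surjective (IsOpenImmersion.lift hU.fromSpec g hrange)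
  have hψg : Spec.map ψ ≫ hU.fromSpec = g := by rw [hψ, IsOpenImmersion.lift_fac]
  refine ⟨ψ.hom, ?_⟩
  have h : Spec.map (CommRingCat.ofHom ρ ≫ ψ) = Spec.map (CommRingCat.ofHom θ) := by
    rw [Spec.map_comp, hρ, reassoc_of% hψg, hg]
  exact congrArg CommRingCat.Hom.hom (Spec.map_injective h)

/-- An altered local uniformization, in terms of finitely many affine charts. -/
lemma AdmitsAlteredLocalUniformization.exists_charts {R K : Type u} [CommRing R] [Field K]
    [Algebra R K] (hR : AdmitsAlteredLocalUniformization R K) :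
    ∃ (ι : Type u) (_ : Finite ι) (S : ι → CommRingCat.{u}) (ρ : ∀ j, R →+* S j),
      (∀ j, IsDomain (S j) ∧ IsRegularRing (S j)) ∧
      ∀ (O : ValuationSubring K) (hO : ∀ r : R, algebraMap R K r ∈ O),
        ∃ (j : ι) (O' : Type u) (_ : CommRing O') (_ : IsDomain O') (_ : IsLocalRing O')
          (φ : O →+* O') (ψ : S j →+* O'),
          Function.Injective φ ∧ IsLocalHom φ ∧
            ψ.comp (ρ j) = φ.comp (toValuationSubring R K O hO) := by
  obtain ⟨n, X, f, hX, hval⟩ := hR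
  have hint : ∀ i, IsIntegral (X i) := fun i ↦ (hX i).1
  choose U hU hxU using fun (i : Fin n) (x : X i) ↦
    exists_isAffineOpen_mem_and_subset (x := x) (U := ⊤) trivial
  -- Each model is quasi-compact over an affine scheme, so finitely many affine charts suffice. This
  -- finiteness later allows one exponent `n` for all charts.
  have hcover : ∀ i, ∃ t : Finset (X i), ∀ y : X i, ∃ x ∈ t, y ∈ U i x := by
    intro i
    have := (hX i).2.2.2.2.2
    have : CompactSpace (X i) := QuasiCompact.compactSpace_of_compactSpace (f i)
    obtain ⟨t, -, ht⟩ := isCompact_univ.elim_nhds_subcover (fun x ↦ (U i x : Set (X i)))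
      fun x _ ↦ (U i x).isOpen.mem_nhds (hxU i x).1
    refine ⟨t, fun y ↦ ?_⟩
    simpa using ht (Set.mem_univ y)
  choose t ht using hcover
  have hne : ∀ (i : Fin n) (x : X i), Nonempty (U i x) := fun i x ↦ ⟨⟨x, (hxU i x).1⟩⟩
  choose ρ hρ using fun (i : Fin n) (x : X i) ↦ Spec.map_surjective ((hU i x).fromSpec ≫ f i)
  refine ⟨ULift (Σ i, t i), inferInstance, fun j ↦ Γ(X j.down.1, U j.down.1 j.down.2.1),
    fun j ↦ (ρ j.down.1 j.down.2.1).hom, fun j ↦ ⟨?_, (hX _).2.1.isRegularRing (hU _ _)⟩, ?_⟩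
  · infer_instance
  · intro O hO
    obtain ⟨i, O', _, _, _, φ, g, hφ, hφloc, hg⟩ := hval O hO
    obtain ⟨x, hxt, hx⟩ := ht i (g (closedPoint O'))
    rw [← Spec.map_comp, ← CommRingCat.ofHom_comp] at hg
    obtain ⟨ψ, hψρ⟩ := exists_ringHom_of_mem hg (hU i x) hx (ρ := (ρ i x).hom) (hρ i x)
    exact ⟨⟨i, x, hxt⟩, O', inferInstance, inferInstance, inferInstance, φ, ψ,
      hφ, hφloc, hψρ⟩

end EtaleOpen
end AlteredLocalUniformization

/-! ### Assembling the argument -/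

section Main

open IsLocalRing

namespace EtaleOpen

/-- A solution of the two equations in `K` lies in every valuation ring dominating `R` whose
prolongation is centred on a regular model. -/
lemma mem_valuationSubring_of_curves {R K S O' : Type u} [CommRing R] [IsLocalRing R] [Field K]
    [Algebra R K] [IsFractionRing R K] [CommRing S] [IsDomain S] [IsRegularRing S] [CommRing O']
    [IsDomain O'] [IsLocalRing O'] {O : ValuationSubring K} {hO : ∀ r : R, algebraMap R K r ∈ O}
    (hloc : IsLocalHom (toValuationSubring R K O hO)) {φ : O →+* O'} (hφ : Function.Injective φ)
    [IsLocalHom φ] {ρ : R →+* S} {ψ : S →+* O'}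
    (hψρ : ψ.comp ρ = φ.comp (toValuationSubring R K O hO)) {π : R} (hπ0 : π ≠ 0)
    (hπ : π ∈ maximalIdeal R) {n : ℕ} (hn3 : 3 ≤ n) (hn : IsUnit (n : R))
    (hord : ∀ Q ∈ (Ideal.span {ρ π}).minimalPrimes, ∀ s ∉ Q, s * ρ π ∉ Q ^ n)
    {x y z : K} (hy : x ^ n + y ^ n = 1)
    (hz : z ^ n * (x + algebraMap R K π) = algebraMap R K π * (x + 1)) : x ∈ O := by
  by_contra hx
  have hx0 : x ≠ 0 := by rintro rfl; exact hx O.zero_mem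
  have hθ : ∀ r, ψ (ρ r) = φ (toValuationSubring R K O hO r) := fun r ↦
    congrArg (fun f : R →+* O' ↦ f r) hψρ
  have hval : Function.Injective (toValuationSubring R K O hO) := fun a b h ↦
    IsFractionRing.injective R K (congrArg Subtype.val h)
  have hρ : Function.Injective ρ := fun a b h ↦ hval (hφ (by rw [← hθ, ← hθ, h]))
  -- The centre of the prolonged ring on the chart. It contains `π` because `R → O → O'` is local.
  let P₀ : Ideal S := (maximalIdeal O').comap ψ
  have hP₀ : P₀.IsPrime := inferInstance
  have hπP : ρ π ∈ P₀ := by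
    change ψ (ρ π) ∈ maximalIdeal O'
    rw [hθ, mem_maximalIdeal, mem_nonunits_iff, isUnit_map_iff, isUnit_map_iff]
    exact hπ
  have hnP : (n : S) ∉ P₀ := by
    intro h
    have hu := (hn.map ρ).map ψ
    rw [map_natCast] at hu
    exact (mem_maximalIdeal _).1 h hu
  have hinj : Function.Injective ((algebraMap S (FractionRing S)).comp ρ) := by
    rw [RingHom.coe_comp]
    exact (IsFractionRing.injective S _).comp hρ
  let σ : K →+* FractionRing S := IsFractionRing.lift hinj
  have hσ : ∀ r, σ (algebraMap R K r) = algebraMap S _ (ρ r) := IsFractionRing.lift_algebraMap hinj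
  obtain ⟨a, s, hs, has⟩ := exists_mul_eq_of_curves (S := S) (P₀ := P₀) (π := ρ π)
    (x := σ x) (y := σ y) (z := σ z)
    ((map_ne_zero_iff ρ hρ).2 hπ0) hπP hn3 hnP hord
    (by rw [← map_pow, ← map_pow, ← map_add, hy, map_one])
    (by rw [← hσ, ← map_add, ← map_pow, ← map_mul, hz, map_mul, map_add, map_one])
  have : IsDomain R := hρ.isDomain ρ
  obtain ⟨r₁, r₂, hr₂, rfl⟩ := IsFractionRing.div_surjective (A := R) x
  have hr₂0 : algebraMap R K r₂ ≠ 0 := by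
    rintro h; rw [h, div_zero] at hx0; exact hx0 rfl
  have hr₁0 : algebraMap R K r₁ ≠ 0 := by
    rintro h; rw [h, zero_div] at hx0; exact hx0 rfl
  have hrs : ρ r₁ * s = ρ r₂ * a := by
    apply IsFractionRing.injective S (FractionRing S)
    rw [map_mul, map_mul, ← has, ← hσ, ← hσ, ← mul_assoc, ← map_mul, mul_div_cancel₀ _ hr₂0]
  have hw : (algebraMap R K r₁ / algebraMap R K r₂)⁻¹ ∈ O := (O.mem_or_inv_mem _).resolve_left hx
  have hwr : (⟨_, hw⟩ : O) * toValuationSubring R K O hO r₁ = toValuationSubring R K O hO r₂ := by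
    apply Subtype.ext
    change (algebraMap R K r₁ / algebraMap R K r₂)⁻¹ * algebraMap R K r₁ = algebraMap R K r₂
    field_simp
  have hne : φ (toValuationSubring R K O hO r₁) ≠ 0 := by
    rw [Ne, map_eq_zero_iff φ hφ]
    exact fun h ↦ hr₁0 (congrArg Subtype.val h)
  -- Writing `x = a / s` on the chart gives `s = x⁻¹ a` in `O'`. As `x ∉ O`, its inverse is a
  -- non-unit of `O`, which forces `s ∈ P₀`.
  have hψs : ψ s = φ ⟨_, hw⟩ * ψ a := by
    apply mul_left_cancel₀ hne
    rw [← hθ, ← map_mul, hrs, map_mul, hθ, hθ, ← hwr, map_mul]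
    ring
  refine hs ?_
  change ψ s ∈ maximalIdeal O'
  rw [hψs]
  refine Ideal.mul_mem_right _ _ ?_
  rw [mem_maximalIdeal, mem_nonunits_iff, isUnit_map_iff]
  rintro hu
  obtain ⟨v, hv⟩ := hu.exists_right_inv
  have hv' : (algebraMap R K r₁ / algebraMap R K r₂)⁻¹ * (v : K) = 1 := congrArg Subtype.val hv
  rw [inv_mul_eq_one₀ hx0] at hv'
  exact hx (hv' ▸ v.2)

/-- In a local ring, all sufficiently large prime numbers are units. -/
lemma exists_forall_isUnit_natCast (R : Type*) [CommRing R] [IsLocalRing R] :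
    ∃ N : ℕ, ∀ n : ℕ, n.Prime → N ≤ n → IsUnit (n : R) := by
  refine ⟨ringChar (ResidueField R) + 1, fun n hn hN ↦ ?_⟩
  by_contra h
  have h0 : (n : ResidueField R) = 0 := by
    rw [← map_natCast (residue R), residue_eq_zero_iff]
    exact h
  have hdvd := (ringChar.spec (ResidueField R) n).1 h0
  rcases (Nat.dvd_prime hn).1 hdvd with h1 | h1
  · have := CharP.ringChar_ne_one (R := ResidueField R)
    exact this h1
  · omega

/-- A suitable exponent and element for which the two equations characterise integrality. -/
lemma AdmitsAlteredLocalUniformization.exists_mem_range_of_curves {R K : Type u} [CommRing R]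
    [IsDomain R] [IsLocalRing R] [IsNoetherianRing R] [IsIntegrallyClosed R] [Field K] [Algebra R K]
    [IsFractionRing R K] (hR : AdmitsAlteredLocalUniformization R K) {π : R} (hπ0 : π ≠ 0)
    (hπ : π ∈ maximalIdeal R) :
    ∃ n : ℕ, 3 ≤ n ∧ IsUnit (n : R) ∧ ∀ x y z : K, x ^ n + y ^ n = 1 →
      z ^ n * (x + algebraMap R K π) = algebraMap R K π * (x + 1) →
        x ∈ (algebraMap R K).range := by
  obtain ⟨ι, _, S, ρ, hS, hval⟩ := hR.exists_charts
  have hN : ∀ j, ∃ N, ρ j π ≠ 0 → ∀ n, N ≤ n →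
      ∀ Q ∈ (Ideal.span {ρ j π}).minimalPrimes, ∀ s ∉ Q, s * ρ j π ∉ Q ^ n := by
    intro j
    have := (hS j).1
    have := (hS j).2
    by_cases h : ρ j π = 0
    · exact ⟨0, fun h' ↦ (h' h).elim⟩
    · obtain ⟨N, hN⟩ := exists_forall_mul_notMem_pow h
      exact ⟨N, fun _ ↦ hN⟩
  choose N hN using hN
  obtain ⟨M, hM⟩ := (Set.finite_range N).bddAbove
  obtain ⟨N', hN'⟩ := exists_forall_isUnit_natCast R
  -- The exponent must exceed the order bounds on all charts, be invertible in `R`, and be at least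
  -- `3` for Fermat.
  obtain ⟨n, hn, hnp⟩ := Nat.exists_infinite_primes (M + N' + 3)
  have hnu : IsUnit (n : R) := hN' n hnp (by omega)
  refine ⟨n, by omega, hnu, fun x y z hy hz ↦ ?_⟩
  by_contra hx
  obtain ⟨O, hO, hloc, hxO⟩ := exists_valuationSubring_of_notMem_range hx
  obtain ⟨j, O', _, _, _, φ, ψ, hφ, hφloc, hψρ⟩ := hval O hO
  have := (hS j).1
  have := (hS j).2
  have hρπ : ρ j π ≠ 0 := by
    intro h
    have h1 : φ (toValuationSubring R K O hO π) = 0 := by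
      rw [← RingHom.comp_apply, ← hψρ, RingHom.comp_apply, h, map_zero]
    rw [map_eq_zero_iff φ hφ] at h1
    exact hπ0 (IsFractionRing.injective R K ((congrArg Subtype.val h1).trans (map_zero _).symm))
  exact hxO (mem_valuationSubring_of_curves hloc hφ hψρ hπ0 hπ (by omega) hnu
    (hN j hρπ n (le_trans (hM ⟨j, rfl⟩) (by omega))) hy hz)

end EtaleOpen

open Polynomial in
theorem theorem4p1 (R K : Type u) [CommRing R] [IsDomain R] [IsLocalRing R] [IsNoetherianRing R]
    [IsIntegrallyClosed R] [Field K] [Algebra R K] [IsFractionRing R K]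
    (hRK : ¬ Function.Surjective (algebraMap R K))
    (hR : EtaleOpen.AdmitsAlteredLocalUniformization R K)
    (V : Over (Spec (CommRingCat.of K))) (hV : EtaleOpen.IsVariety V) :
    EtaleOpen.etaleOpenTopology V ≤ EtaleOpen.pointsTopology (EtaleOpen.adicTopology R K) V := by
  classical
  have hfield : ¬ IsField R := fun h ↦ hRK (IsFractionRing.surjective_iff_isField.2 h)
  obtain ⟨π, hπ, hπ0⟩ := Submodule.exists_mem_ne_zero_of_ne_bot
    (mt IsLocalRing.isField_iff_maximalIdeal_eq.2 hfield)
  have hπK : algebraMap R K π ≠ 0 := (map_ne_zero_iff _ (IsFractionRing.injective R K)).2 hπ0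
  obtain ⟨n, hn3, hnu, hn⟩ := hR.exists_mem_range_of_curves hπ0 hπ
  have hnK : (n : K) ≠ 0 := by
    rw [← map_natCast (algebraMap R K)]
    exact (hnu.map _).ne_zero
  have hn0 : n ≠ 0 := by omega
  let h₁ : K[X] := 1 - X ^ n
  -- The factor `(x + π) ^ (n - 1)` replaces the quotient `π (x + 1) / (x + π)` by a polynomial in
  -- the same class modulo `n`-th powers. Its value at `0` is then `π ^ n`.
  let h₂ : K[X] := C (algebraMap R K π) * (X + 1) * (X + C (algebraMap R K π)) ^ (n - 1)
  refine EtaleOpen.etaleOpenTopology_le_pointsTopology (fun V hV ↦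
    EtaleOpen.etaleOpenTopology_le_affinePointsTopology hnK {h₁, h₂} ?_ ?_ V hV) V hV
  · simp only [Finset.mem_insert, Finset.mem_singleton, forall_eq_or_imp, forall_eq]
    have e₁ : h₁.eval 0 = 1 := by simp [h₁, hn0]
    have e₂ : h₂.eval 0 = algebraMap R K π ^ n := by
      simp [h₂, ← pow_succ', Nat.sub_add_cancel (show 1 ≤ n by omega)]
    rw [e₁, e₂]
    exact ⟨⟨one_ne_zero, 1, one_pow n⟩, pow_ne_zero _ hπK, _, rfl⟩
  · intro x hx
    simp only [Finset.mem_insert, Finset.mem_singleton, forall_eq_or_imp, forall_eq] at hx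
    obtain ⟨⟨-, y, hy⟩, h0, z, hz⟩ := hx
    have e₁ : h₁.eval x = 1 - x ^ n := by simp [h₁]
    have e₂ : h₂.eval x =
        algebraMap R K π * (x + 1) * (x + algebraMap R K π) ^ (n - 1) := by simp [h₂]
    rw [e₁] at hy
    rw [e₂] at h0 hz
    have hxπ : x + algebraMap R K π ≠ 0 := fun h ↦ h0 (by
      rw [h, zero_pow (by omega), mul_zero])
    -- Dividing the `n`-th root of `h₂` at `x` by `x + π` recovers the second curve.
    refine hn x y (z / (x + algebraMap R K π)) (by rw [hy]; ring) ?_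
    rw [div_pow, hz]
    obtain ⟨m, rfl⟩ : ∃ m, n = m + 1 := ⟨n - 1, by omega⟩
    rw [Nat.add_sub_cancel, pow_succ]
    field_simp

end Main
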